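/- Let there be $m$ candidates with arbitrary real weights $w_i\ge 0$, $n$ voters, and a weight limit $K>0$. A committee is a set $S$ of candidates, and $w(S)=\sum_{i\in S}w_i$. Voters have preferences over committees; $V(S,S')$ denotes the number of voters who strictly prefer $S'$ to $S$. For $c\ge 1$, a committee $S$ with $w(S)\le K$ is \emph{$c$-approximately stable} if there is no committee $S'$ with $V(S,S')>0$ and $V(S,S')\ge c\cdot\frac{w(S')}{K}\cdot n$; it is \emph{$(c,1)$-approximately stable} if there is no such $S'$ with at most one candidate. In the \emph{Ranking} setting, each voter has a complete transitive ordering of the candidates (ties allowed) and compares committees by her favourite members. In the \emph{Facility Location} setting, there is a (pseudo)metric on the disjoint union of candidates and voters, and each voter prefers committees whose closest member is at smaller distance from her. In both settings every non-empty committee is strictly preferred to the empty one. (a) There are $\varepsilon_0>0$, a polynomial $Q$ and one deterministic real-RAM program (counters and addresses with addition and truncated subtraction; real registers with $+,-,\times,\div$ and comparisons; unit cost per operation) such that for all $0<\varepsilon\le\varepsilon_0$, all $m,n$, all weights $w_i\ge0$ and all $K>0$ the following holds. Given $m,n,\varepsilon,K,w$ and, for each voter and candidate, the position of the candidate in the voter's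 ordering (Ranking) or the distance between the two (Facility Location), the program halts within $Q(m,n,1/\varepsilon)$ steps and outputs a committee of weight at most $K$ that is $(32+\varepsilon)$-approximately stable. (b) In both settings, for all weights $w_i\ge 0$, all $K>0$ and all $c\ge1$, a committee is $c$-approximately stable if and only if it is $(c,1)$-approximately stable. -/

import Mathlib

namespace CommitteeSelection

/-! ### Committee selection -/

/-- Preferences of `n` voters over the committees (all subsets of the `m` candidates):
`P.weak v S T` says that voter `v` weakly prefers `S` to `T`. Preferences are complete,
transitive and monotone. -/
structure Preferences (n m : ℕ) where
  weak : Fin n → Finset (Fin m) → Finset (Fin m) → Prop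
  complete : ∀ v S T, weak v S T ∨ weak v T S
  transitive : ∀ v S T U, weak v S T → weak v T U → weak v S U
  monotone : ∀ v S T, T ⊆ S → weak v S T

/-- Voter `v` strictly prefers `S` to `T`. -/
def Preferences.strict {n m : ℕ} (P : Preferences n m) (v : Fin n) (S T : Finset (Fin m)) : Prop :=
  P.weak v S T ∧ ¬ P.weak v T S

/-- The additive weight of a committee. -/
def weight {m : ℕ} (w : Fin m → ℝ) (S : Finset (Fin m)) : ℝ := ∑ i ∈ S, w i

open Classical in
/-- The pairwise score of `S'` over `S`: the number of voters who strictly prefer `S'` to `S`. -/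
noncomputable def pairwiseScore {n m : ℕ} (P : Preferences n m) (S S' : Finset (Fin m)) : ℕ :=
  (Finset.univ.filter (fun v : Fin n => P.strict v S' S)).card

/-- `S'` `c`-blocks `S` under the weight limit `K`: the coalition of all voters who strictly
prefer `S'` to `S` is non-empty, and its size is at least `c * (w(S') / K) * n`. -/
def Blocks {n m : ℕ} (P : Preferences n m) (w : Fin m → ℝ) (K c : ℝ) (S S' : Finset (Fin m)) :
    Prop :=
  0 < pairwiseScore P S S' ∧ c * (weight w S' / K) * (n : ℝ) ≤ (pairwiseScore P S S' : ℝ)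

/-- `S` is a `c`-approximately stable committee of weight at most `K`. -/
def IsApproxStable {n m : ℕ} (P : Preferences n m) (w : Fin m → ℝ) (K c : ℝ)
    (S : Finset (Fin m)) : Prop :=
  weight w S ≤ K ∧ ∀ S' : Finset (Fin m), ¬ Blocks P w K c S S'

/-- `S` is a `(c, L)`-approximately stable committee of weight at most `K`: it is not `c`-blocked
by a committee with at most `L` candidates. -/
def IsApproxStableUpTo {n m : ℕ} (P : Preferences n m) (w : Fin m → ℝ) (K c : ℝ) (L : ℕ)
    (S : Finset (Fin m)) : Prop :=
  weight w S ≤ K ∧ ∀ S' : Finset (Fin m), S'.card ≤ L → ¬ Blocks P w K c S S'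

/-! ### Ranking -/

/-- A preference ordering over the candidates for each voter; ties are allowed.
`R.pref v i j` says that voter `v` ranks `i` at least as high as `j`. -/
structure RankingProfile (n m : ℕ) where
  pref : Fin n → Fin m → Fin m → Prop
  complete : ∀ v i j, pref v i j ∨ pref v j i
  transitive : ∀ v i j k, pref v i j → pref v j k → pref v i k

/-- Voters compare committees by their favourite member: `S` is weakly preferred to `T` if every
member of `T` is matched or beaten by some member of `S`. In particular every non-empty committee
is strictly preferred to the empty one. -/
def RankingProfile.preferences {n m : ℕ} (R : RankingProfile n m) : Preferences n m where
  weak v S T := ∀ j ∈ T, ∃ i ∈ S, R.pref v i j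
  complete v S T := by
    by_contra h
    push Not at h
    obtain ⟨⟨j, hj, h1⟩, i, hi, h2⟩ := h
    rcases R.complete v i j with h | h
    · exact h1 i hi h
    · exact h2 j hj h
  transitive v S T U h1 h2 k hk := by
    obtain ⟨j, hj, hjk⟩ := h2 k hk
    obtain ⟨i, hi, hij⟩ := h1 j hj
    exact ⟨i, hi, R.transitive v i j k hij hjk⟩
  monotone v S T h j hj := ⟨j, h hj, (R.complete v j j).elim id id⟩

/-- `S` is strictly preferred to `T` iff some member of `S` is ranked strictly higher than all
members of `T`. -/
theorem RankingProfile.strict_iff {n m : ℕ} (R : RankingProfile n m) (v : Fin n)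
    (S T : Finset (Fin m)) :
    R.preferences.strict v S T ↔ ∃ i ∈ S, ∀ j ∈ T, R.pref v i j ∧ ¬ R.pref v j i := by
  constructor
  · rintro ⟨-, h⟩
    simp only [RankingProfile.preferences, not_forall, not_exists, not_and] at h
    obtain ⟨i, hi, h⟩ := h
    exact ⟨i, hi, fun j hj => ⟨(R.complete v i j).resolve_right (h j hj), h j hj⟩⟩
  · rintro ⟨i, hi, h⟩
    refine ⟨fun j hj => ⟨i, hi, (h j hj).1⟩, fun h' => ?_⟩
    obtain ⟨j, hj, hji⟩ := h' i hi
    exact (h j hj).2 hji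

open Classical in
/-- The position of candidate `i` in the ordering of voter `v`: the number of candidates that `v`
ranks strictly higher than `i`. -/
noncomputable def RankingProfile.position {n m : ℕ} (R : RankingProfile n m) (v : Fin n)
    (i : Fin m) : ℕ :=
  (Finset.univ.filter (fun j : Fin m => ¬ R.pref v i j)).card

/-! ### Facility location -/

/-- The distance from voter `v` to candidate location `i`, in a metric `d` on the disjoint union of
candidates and voters (points at distance zero are allowed). -/
def voterDist {n m : ℕ} (d : PseudoMetricSpace (Fin m ⊕ Fin n)) (v : Fin n) (i : Fin m) : ℝ :=
  d.dist (Sum.inr v) (Sum.inl i)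

/-- The cost of voter `v` for `S`: the distance to the closest facility, infinite if there is
none. -/
noncomputable def facilityCost {n m : ℕ} (d : PseudoMetricSpace (Fin m ⊕ Fin n)) (v : Fin n)
    (S : Finset (Fin m)) : WithTop ℝ :=
  S.inf (fun i => (voterDist d v i : WithTop ℝ))

/-- Voters prefer committees of smaller cost. -/
noncomputable def facilityPreferences {n m : ℕ} (d : PseudoMetricSpace (Fin m ⊕ Fin n)) :
    Preferences n m where
  weak v S T := facilityCost d v S ≤ facilityCost d v T
  complete _ _ _ := le_total _ _
  transitive _ _ _ _ h1 h2 := le_trans h1 h2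
  monotone _ _ _ h := Finset.inf_mono h

/-! ### A real RAM with a step count

A program is a structured program over two memories, one for natural numbers (used for counters
and addresses) and one for real numbers. Each memory consists of two-dimensional arrays numbered
`0, 1, 2, …`. Natural numbers can be added and (truncated-)subtracted; real numbers can be added,
subtracted, multiplied and divided (division by zero gives zero). There are no real constants
other than natural numbers, no rounding and no roots. Every operation, memory access, assignment
and test takes one unit of time. -/

/-- The memory: `s.nat a i j` is the cell `a[i][j]` of the memory for natural numbers, and
`s.real a i j` that of the memory for real numbers. -/
structure State where
  nat : ℕ → ℕ → ℕ → ℕ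
  real : ℕ → ℕ → ℕ → ℝ

/-- Expressions with values in the natural numbers. -/
inductive NatExpr
  | const (k : ℕ)
  | get (a : ℕ) (i j : NatExpr)
  | add (x y : NatExpr)
  | sub (x y : NatExpr)

/-- Expressions with values in the real numbers. -/
inductive RealExpr
  | ofNat (x : NatExpr)
  | get (a : ℕ) (i j : NatExpr)
  | add (x y : RealExpr)
  | sub (x y : RealExpr)
  | mul (x y : RealExpr)
  | div (x y : RealExpr)

/-- Tests. -/
inductive Test
  | natLt (x y : NatExpr)
  | realLt (x y : RealExpr)

/-- Programs. -/
inductive Program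
  | skip
  | setNat (a : ℕ) (i j x : NatExpr)
  | setReal (a : ℕ) (i j : NatExpr) (x : RealExpr)
  | seq (p q : Program)
  | ite (b : Test) (p q : Program)
  | while (b : Test) (p : Program)

def NatExpr.eval (s : State) : NatExpr → ℕ
  | .const k => k
  | .get a i j => s.nat a (i.eval s) (j.eval s)
  | .add x y => x.eval s + y.eval s
  | .sub x y => x.eval s - y.eval s

def NatExpr.cost : NatExpr → ℕ
  | .const _ => 1
  | .get _ i j => i.cost + j.cost + 1
  | .add x y => x.cost + y.cost + 1
  | .sub x y => x.cost + y.cost + 1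

noncomputable def RealExpr.eval (s : State) : RealExpr → ℝ
  | .ofNat x => (x.eval s : ℝ)
  | .get a i j => s.real a (i.eval s) (j.eval s)
  | .add x y => x.eval s + y.eval s
  | .sub x y => x.eval s - y.eval s
  | .mul x y => x.eval s * y.eval s
  | .div x y => x.eval s / y.eval s

def RealExpr.cost : RealExpr → ℕ
  | .ofNat x => x.cost + 1
  | .get _ i j => i.cost + j.cost + 1
  | .add x y => x.cost + y.cost + 1
  | .sub x y => x.cost + y.cost + 1
  | .mul x y => x.cost + y.cost + 1
  | .div x y => x.cost + y.cost + 1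

def Test.holds (s : State) : Test → Prop
  | .natLt x y => x.eval s < y.eval s
  | .realLt x y => x.eval s < y.eval s

def Test.cost : Test → ℕ
  | .natLt x y => x.cost + y.cost + 1
  | .realLt x y => x.cost + y.cost + 1

/-- The state after the assignment `a[i][j] := x` in the memory for natural numbers. -/
def State.setNat (s : State) (a i j x : ℕ) : State :=
  { s with nat := fun a' i' j' => if a' = a ∧ i' = i ∧ j' = j then x else s.nat a' i' j' }

/-- The state after the assignment `a[i][j] := x` in the memory for real numbers. -/
noncomputable def State.setReal (s : State) (a i j : ℕ) (x : ℝ) : State :=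
  { s with real := fun a' i' j' => if a' = a ∧ i' = i ∧ j' = j then x else s.real a' i' j' }

/-- `Runs p s s' t`: started in state `s`, the program `p` halts after `t` steps in state `s'`. -/
inductive Runs : Program → State → State → ℕ → Prop
  | skip (s : State) : Runs .skip s s 1
  | setNat (s : State) (a : ℕ) (i j x : NatExpr) :
      Runs (.setNat a i j x) s (s.setNat a (i.eval s) (j.eval s) (x.eval s))
        (i.cost + j.cost + x.cost + 1)
  | setReal (s : State) (a : ℕ) (i j : NatExpr) (x : RealExpr) :
      Runs (.setReal a i j x) s (s.setReal a (i.eval s) (j.eval s) (x.eval s))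
        (i.cost + j.cost + x.cost + 1)
  | seq {p q : Program} {s s' s'' : State} {t t' : ℕ} :
      Runs p s s' t → Runs q s' s'' t' → Runs (.seq p q) s s'' (t + t')
  | ite_true {b : Test} {p q : Program} {s s' : State} {t : ℕ} :
      b.holds s → Runs p s s' t → Runs (.ite b p q) s s' (b.cost + t)
  | ite_false {b : Test} {p q : Program} {s s' : State} {t : ℕ} :
      ¬ b.holds s → Runs q s s' t → Runs (.ite b p q) s s' (b.cost + t)
  | while_true {b : Test} {p : Program} {s s' s'' : State} {t t' : ℕ} :
      b.holds s → Runs p s s' t → Runs (.while b p) s' s'' t' →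
        Runs (.while b p) s s'' (b.cost + t + t')
  | while_false {b : Test} {p : Program} {s : State} :
      ¬ b.holds s → Runs (.while b p) s s b.cost

/-- Programs are deterministic: the final state and the number of steps are unique. -/
theorem Runs.unique {p : Program} {s s₁ s₂ : State} {t₁ t₂ : ℕ} (h₁ : Runs p s s₁ t₁)
    (h₂ : Runs p s s₂ t₂) : s₁ = s₂ ∧ t₁ = t₂ := by
  induction h₁ generalizing s₂ t₂ with
  | skip | setNat | setReal => cases h₂; exact ⟨rfl, rfl⟩
  | seq _ _ ih ih' =>
    cases h₂ with
    | seq a b =>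
      obtain ⟨rfl, rfl⟩ := ih a
      obtain ⟨rfl, rfl⟩ := ih' b
      exact ⟨rfl, rfl⟩
  | ite_true hb _ ih =>
    cases h₂ with
    | ite_true _ a => obtain ⟨rfl, rfl⟩ := ih a; exact ⟨rfl, rfl⟩
    | ite_false hb' _ => exact absurd hb hb'
  | ite_false hb _ ih =>
    cases h₂ with
    | ite_true hb' _ => exact absurd hb' hb
    | ite_false _ a => obtain ⟨rfl, rfl⟩ := ih a; exact ⟨rfl, rfl⟩
  | while_true hb _ _ ih ih' =>
    cases h₂ with
    | while_true _ a b =>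
      obtain ⟨rfl, rfl⟩ := ih a
      obtain ⟨rfl, rfl⟩ := ih' b
      exact ⟨rfl, rfl⟩
    | while_false hb' => exact absurd hb hb'
  | while_false hb =>
    cases h₂ with
    | while_true hb' _ _ => exact absurd hb' hb
    | while_false _ => exact ⟨rfl, rfl⟩

/-! ### Input and output -/

/-- The initial memory. Natural numbers: `0[0][0] = m`, `1[0][0] = n`. Real numbers: `0[0][0] = ε`,
`1[0][0] = K`, `2[i][0] = w i` for each candidate `i`, and `3[v][i] = x v i` for each voter `v` and
candidate `i`. All other cells are zero. -/
noncomputable def input {n m : ℕ} (ε K : ℝ) (w : Fin m → ℝ) (x : Fin n → Fin m → ℝ) : State where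
  nat a i j :=
    if a = 0 ∧ i = 0 ∧ j = 0 then m
    else if a = 1 ∧ i = 0 ∧ j = 0 then n
    else 0
  real a i j :=
    if a = 0 ∧ i = 0 ∧ j = 0 then ε
    else if a = 1 ∧ i = 0 ∧ j = 0 then K
    else if h : a = 2 ∧ i < m ∧ j = 0 then w ⟨i, h.2.1⟩
    else if h : a = 3 ∧ i < n ∧ j < m then x ⟨i, h.2.1⟩ ⟨j, h.2.2⟩
    else 0

/-- The committee that a final memory describes: candidate `i` is a member iff the cell `2[i][0]`
of the memory for natural numbers is `1`. -/
def output (m : ℕ) (s : State) : Finset (Fin m) :=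
  Finset.univ.filter (fun i : Fin m => s.nat 2 i 0 = 1)

/-- Started on `ε`, `K`, `w` and the table `x`, the program `p` halts within `T` steps and outputs
a committee of weight at most `K` that is `c`-approximately stable for the preferences `P`. -/
def ComputesStable {n m : ℕ} (p : Program) (T : ℝ) (ε K : ℝ) (w : Fin m → ℝ)
    (x : Fin n → Fin m → ℝ) (P : Preferences n m) (c : ℝ) : Prop :=
  ∃ (s : State) (t : ℕ), Runs p (input ε K w x) s t ∧ (t : ℝ) ≤ T ∧
    IsApproxStable P w K c (output m s)

end CommitteeSelection

/-! A voter who prefers one committee to another already prefers a single member of it. So pairwise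
scores are subadditive over the members of the deviation, while the blocking thresholds are
additive. This gives (b), and for (a) it leaves only deviations to one candidate
(`isApproxStable_iff_upTo_one`).

For (a), all candidates of weight at most K/(16m) are taken first; together they weigh at most K/16.
The rest of the limit is spent in stages with budgets κ = (15K/32)/2^t. Voters carry weights z,
initially 1, with total Z. A stage builds a lottery, that is T committees of weight at most κ, such
that on average each large candidate i beats them for voters of total weight at most (51/16) w_i
Z/κ. One committee b is kept, and z_v is multiplied by max(0, 1 - 2u_v), where u_v is the fraction
of the lottery that v likes no better than b. Averaged over b, this factor is at most 1/4
(`sum_upperCount_deficit_le`), so some b reduces Z to at most Z/4 while κ is only halved. A voter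
who prefers i to b prefers i to everything counted in u_v; hence the dissenters of i together lose
at most 2(51/16) w_i Z/κ. These losses form a geometric series with sum (136/5) w_i n/K
(`StageInv.succ`). After n + 2 stages Z is at most 1/16, so a non-empty set of dissenters has lost
at least 15/16 of its initial weight, and its size is below 32 w_i n/K
(`StageInv.card_dissenters_lt`).

The lottery is an approximate minimax strategy. Against candidate weights q a committee is built
greedily. Of two independent draws from q, the first is at least as good as the second with
probability at least 1/2, so some candidate covers enough for its weight (`exists_gain_ge`). The
uncovered mass then decays like the inverse of the weight spent (`greedy_potential_step`), down to
(3Z/κ) Σ q_i w_i (`GreedyInv.uncovered_le`). Taking for q the truncated accumulated excesses of the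
candidates keeps Σ q_i² linear in the number of rounds, as in Blackwell's approachability theorem
(`RoundInv.succ`), and of order m³ rounds make the error small.

The slack below 32 absorbs all errors, so the running time does not depend on ε. The program is
verified by Hoare-style rules in which one number M bounds the iterations of every loop; the time is
polynomial in M. -/

namespace CommitteeSelection

/-! ### Reasoning about programs -/

@[simp] theorem State.setNat_nat (s : State) (a i j x a' i' j' : ℕ) :
    (s.setNat a i j x).nat a' i' j' =
      if a' = a ∧ i' = i ∧ j' = j then x else s.nat a' i' j' := rfl

@[simp] theorem State.setNat_real (s : State) (a i j x : ℕ) : (s.setNat a i j x).real = s.real :=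
  rfl

@[simp] theorem State.setReal_nat (s : State) (a i j : ℕ) (x : ℝ) :
    (s.setReal a i j x).nat = s.nat := rfl

@[simp] theorem State.setReal_real (s : State) (a i j : ℕ) (x : ℝ) (a' i' j' : ℕ) :
    (s.setReal a i j x).real a' i' j' =
      if a' = a ∧ i' = i ∧ j' = j then x else s.real a' i' j' := rfl

/-- An upper bound for the running time when every loop makes at most `M` iterations each time it
is entered. -/
def Program.timeBound (M : ℕ) : Program → ℕ
  | .skip => 1
  | .setNat _ i j x => i.cost + j.cost + x.cost + 1
  | .setReal _ i j x => i.cost + j.cost + x.cost + 1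
  | .seq p q => p.timeBound M + q.timeBound M
  | .ite b p q => b.cost + (p.timeBound M + q.timeBound M)
  | .while b p => M * (b.cost + p.timeBound M) + b.cost

/-- Each level of loop nesting contributes one factor M, so the degree depends on the program text
only. Polynomial time thus reduces to one polynomial bound on the iterations of all loops. -/
theorem Program.exists_timeBound_eq_eval (p : Program) :
    ∃ P : Polynomial ℕ, ∀ M, p.timeBound M = P.eval M := by
  induction p with
  | skip => exact ⟨1, fun M => by simp [timeBound]⟩
  | setNat a i j x => exact ⟨.C (i.cost + j.cost + x.cost + 1), fun M => by
      simp only [timeBound, Polynomial.eval_C]⟩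
  | setReal a i j x => exact ⟨.C (i.cost + j.cost + x.cost + 1), fun M => by
      simp only [timeBound, Polynomial.eval_C]⟩
  | seq p q hp hq =>
    obtain ⟨P, hP⟩ := hp
    obtain ⟨Q, hQ⟩ := hq
    exact ⟨P + Q, fun M => by simp [timeBound, hP, hQ]⟩
  | ite b p q hp hq =>
    obtain ⟨P, hP⟩ := hp
    obtain ⟨Q, hQ⟩ := hq
    exact ⟨.C b.cost + (P + Q), fun M => by
      simp only [timeBound, hP, hQ, Polynomial.eval_C, Polynomial.eval_add]⟩
  | _ b p hp =>
    obtain ⟨P, hP⟩ := hp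
    exact ⟨.X * (.C b.cost + P) + .C b.cost, fun M => by
      simp only [timeBound, hP, Polynomial.eval_C, Polynomial.eval_add, Polynomial.eval_mul,
        Polynomial.eval_X]⟩

/-- The arrays for natural numbers that occur on the left of an assignment. -/
def Program.natWrites : Program → List ℕ
  | .skip => []
  | .setNat a _ _ _ => [a]
  | .setReal _ _ _ _ => []
  | .seq p q => p.natWrites ++ q.natWrites
  | .ite _ p q => p.natWrites ++ q.natWrites
  | .while _ p => p.natWrites

/-- The arrays for real numbers that occur on the left of an assignment. -/
def Program.realWrites : Program → List ℕ
  | .skip => []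
  | .setNat _ _ _ _ => []
  | .setReal a _ _ _ => [a]
  | .seq p q => p.realWrites ++ q.realWrites
  | .ite _ p q => p.realWrites ++ q.realWrites
  | .while _ p => p.realWrites

/-- The two states agree except possibly on the arrays that the program assigns to. -/
def Agree (p : Program) (s s' : State) : Prop :=
  (∀ a, a ∉ p.natWrites → s'.nat a = s.nat a) ∧ ∀ a, a ∉ p.realWrites → s'.real a = s.real a

theorem Agree.refl (p : Program) (s : State) : Agree p s s := ⟨fun _ _ => rfl, fun _ _ => rfl⟩

theorem Agree.trans {p : Program} {s₁ s₂ s₃ : State} (h : Agree p s₁ s₂) (h' : Agree p s₂ s₃) :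
    Agree p s₁ s₃ :=
  ⟨fun a ha => (h'.1 a ha).trans (h.1 a ha), fun a ha => (h'.2 a ha).trans (h.2 a ha)⟩

theorem Agree.mono {p q : Program} {s s' : State} (h : Agree p s s')
    (hn : p.natWrites ⊆ q.natWrites) (hr : p.realWrites ⊆ q.realWrites) : Agree q s s' :=
  ⟨fun a ha => h.1 a fun h => ha (hn h), fun a ha => h.2 a fun h => ha (hr h)⟩

/-- The frame rule. Write sets are explicit lists of array numbers, so for a concrete program
`decide` settles which arrays survive. -/
theorem Runs.agree {p : Program} {s s' : State} {t : ℕ} (h : Runs p s s' t) : Agree p s s' := by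
  induction h with
  | skip => exact .refl _ _
  | setNat s a i j x =>
    refine ⟨fun b hb => ?_, fun _ _ => rfl⟩
    have : b ≠ a := by simpa [Program.natWrites] using hb
    funext i' j'
    simp [this]
  | setReal s a i j x =>
    refine ⟨fun _ _ => rfl, fun b hb => ?_⟩
    have : b ≠ a := by simpa [Program.realWrites] using hb
    funext i' j'
    simp [this]
  | seq _ _ h h' =>
    exact (h.mono (by simp [Program.natWrites]) (by simp [Program.realWrites])).trans
      (h'.mono (by simp [Program.natWrites]) (by simp [Program.realWrites]))
  | ite_true _ _ h => exact h.mono (by simp [Program.natWrites]) (by simp [Program.realWrites])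
  | ite_false _ _ h => exact h.mono (by simp [Program.natWrites]) (by simp [Program.realWrites])
  | while_true _ _ _ h h' =>
    exact (h.mono (by simp [Program.natWrites]) (by simp [Program.realWrites])).trans h'
  | while_false => exact .refl _ _

/-- Started in `s`, the program halts within its time bound in a state with the property `Q`. -/
def WP (M : ℕ) (p : Program) (Q : State → Prop) (s : State) : Prop :=
  ∃ s' t, Runs p s s' t ∧ t ≤ p.timeBound M ∧ Q s'

/-! ### Proof rules for total correctness within the time bound -/

section WP

variable {M : ℕ} {p q : Program} {Q Q' : State → Prop} {s : State}

/-- The frame is handed to the continuation, so that specifications need to mention only what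
changes. -/
theorem WP.mono (h : WP M p Q s) (hQ : ∀ s', Agree p s s' → Q s' → Q' s') : WP M p Q' s := by
  obtain ⟨s', t, h1, h2, h3⟩ := h
  exact ⟨s', t, h1, h2, hQ _ h1.agree h3⟩

theorem WP.skip (h : Q s) : WP M .skip Q s := ⟨s, 1, .skip s, le_rfl, h⟩

theorem WP.setNat {a : ℕ} {i j x : NatExpr}
    (h : Q (s.setNat a (i.eval s) (j.eval s) (x.eval s))) : WP M (.setNat a i j x) Q s :=
  ⟨_, _, .setNat s a i j x, le_rfl, h⟩

theorem WP.setReal {a : ℕ} {i j : NatExpr} {x : RealExpr}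
    (h : Q (s.setReal a (i.eval s) (j.eval s) (x.eval s))) : WP M (.setReal a i j x) Q s :=
  ⟨_, _, .setReal s a i j x, le_rfl, h⟩

theorem WP.seq (h : WP M p (WP M q Q) s) : WP M (.seq p q) Q s := by
  obtain ⟨s', t, h1, h2, s'', t', h3, h4, h5⟩ := h
  exact ⟨s'', _, .seq h1 h3, Nat.add_le_add h2 h4, h5⟩

theorem WP.ite {b : Test} (h : b.holds s → WP M p Q s) (h' : ¬ b.holds s → WP M q Q s) :
    WP M (.ite b p q) Q s := by
  by_cases hb : b.holds s
  · obtain ⟨s', t, h1, h2, h3⟩ := h hb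
    exact ⟨s', _, .ite_true hb h1, by simp only [Program.timeBound]; omega, h3⟩
  · obtain ⟨s', t, h1, h2, h3⟩ := h' hb
    exact ⟨s', _, .ite_false hb h1, by simp only [Program.timeBound]; omega, h3⟩

/-- The invariant is indexed by the number of completed iterations, which yields termination and the
time bound together, by induction on the iterations that remain. -/
theorem WP.while {b : Test} {N : ℕ} (hN : N ≤ M) (I : ℕ → State → Prop) (h0 : I 0 s)
    (hstep : ∀ k, k < N → ∀ s', I k s' → b.holds s' ∧ WP M p (I (k + 1)) s')
    (hend : ∀ s', I N s' → ¬ b.holds s') : WP M (.while b p) (I N) s := by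
  suffices h : ∀ l k, k + l = N → ∀ s, I k s → ∃ s' t, Runs (.while b p) s s' t ∧
      t ≤ l * (b.cost + p.timeBound M) + b.cost ∧ I N s' by
    obtain ⟨s', t, h1, h2, h3⟩ := h N 0 (zero_add _) s h0
    refine ⟨s', t, h1, h2.trans ?_, h3⟩
    simp only [Program.timeBound]
    gcongr
  intro l
  induction l with
  | zero =>
    rintro k rfl s hs
    exact ⟨s, _, .while_false (hend s hs), by simp, hs⟩
  | succ l ih =>
    intro k hk s hs
    obtain ⟨hb, s', t, h1, h2, h3⟩ := hstep k (by omega) s hs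
    obtain ⟨s'', t', h4, h5, h6⟩ := ih (k + 1) (by omega) s' h3
    refine ⟨s'', _, .while_true hb h1 h4, ?_, h6⟩
    rw [Nat.succ_mul]
    omega

/-- The entry `a[0][0]` of the memory for natural numbers. -/
abbrev nvar (a : ℕ) : NatExpr := .get a (.const 0) (.const 0)

/-- The entry `a[0][0]` of the memory for real numbers. -/
abbrev rvar (a : ℕ) : RealExpr := .get a (.const 0) (.const 0)

abbrev setNvar (a : ℕ) (x : NatExpr) : Program := .setNat a (.const 0) (.const 0) x

abbrev setRvar (a : ℕ) (x : RealExpr) : Program := .setReal a (.const 0) (.const 0) x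

/-- Run `p` for the values `0, 1, …, b - 1` of the counter `c`. -/
def forLoop (c : ℕ) (b : NatExpr) (p : Program) : Program :=
  .seq (setNvar c (.const 0))
    (.while (.natLt (nvar c) b) (.seq p (setNvar c (.add (nvar c) (.const 1)))))

/-- The machine evaluates the bound anew before every iteration, hence `hb` for all states in the
frame. The invariant is required after the counter has been incremented, since it may speak of the
whole memory. -/
theorem WP.forLoop {c : ℕ} {b : NatExpr} (N : ℕ) (I : ℕ → State → Prop) (hN : N ≤ M)
    (hb : ∀ s', Agree (forLoop c b p) s s' → b.eval s' = N) (hc : c ∉ p.natWrites)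
    (h0 : I 0 (s.setNat c 0 0 0))
    (hstep : ∀ k, k < N → ∀ s', Agree (CommitteeSelection.forLoop c b p) s s' →
      s'.nat c 0 0 = k → I k s' → WP M p (fun s'' => I (k + 1) (s''.setNat c 0 0 (k + 1))) s')
    (hQ : ∀ s', Agree (CommitteeSelection.forLoop c b p) s s' → I N s' → Q s') :
    WP M (forLoop c b p) Q s := by
  refine WP.mono (Q := fun s' => I N s') ?_ hQ
  refine WP.seq (WP.setNat ?_)
  refine WP.mono (WP.while hN (fun k s' => Agree (CommitteeSelection.forLoop c b p) s s' ∧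
    s'.nat c 0 0 = k ∧ I k s') ⟨?_, ?_, h0⟩ ?_ ?_) fun s' _ h => h.2.2
  · refine ⟨fun a ha => ?_, fun _ _ => rfl⟩
    have : a ≠ c := by
      rintro rfl
      exact ha (by simp [CommitteeSelection.forLoop, Program.natWrites])
    funext i j
    simp [this]
  · simp [NatExpr.eval]
  · rintro k hk s' ⟨h1, h2, h3⟩
    refine ⟨by simpa [Test.holds, NatExpr.eval, h2, hb s' h1] using hk, WP.seq ?_⟩
    refine WP.mono (hstep k hk s' h1 h2 h3) fun s'' h4 h5 => WP.setNat ?_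
    have h6 : s''.nat c 0 0 = k := by rw [h4.1 c hc, h2]
    refine ⟨h1.trans ?_, by simp [NatExpr.eval, h6], by simpa [NatExpr.eval, h6] using h5⟩
    refine Agree.trans (h4.mono (by simp [CommitteeSelection.forLoop, Program.natWrites])
      (by simp [CommitteeSelection.forLoop, Program.realWrites])) ⟨fun a ha => ?_, fun _ _ => rfl⟩
    have : a ≠ c := by
      rintro rfl
      exact ha (by simp [CommitteeSelection.forLoop, Program.natWrites])
    funext i j
    simp [this]
  · rintro s' ⟨h1, h2, h3⟩
    simp [Test.holds, NatExpr.eval, h2, hb s' h1]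

end WP

open Finset

/-! ### Deviations to a single candidate -/

/-- A union bound over the members of the deviation: if each member fails to reach its own
threshold, their scores add up to less than the sum of the thresholds. -/
theorem isApproxStable_iff_upTo_one {n m : ℕ} (P : Preferences n m)
    (h : ∀ v S T, P.strict v T S → ∃ i ∈ T, P.strict v {i} S) (w : Fin m → ℝ) (K c : ℝ)
    (hw : ∀ i, 0 ≤ w i) (hK : 0 < K) (hc : 1 ≤ c) (S : Finset (Fin m)) :
    IsApproxStable P w K c S ↔ IsApproxStableUpTo P w K c 1 S := by
  classical
  refine ⟨fun hS => ⟨hS.1, fun S' _ => hS.2 S'⟩, fun hS => ⟨hS.1, fun S' hb => ?_⟩⟩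
  obtain ⟨h0, hb⟩ := hb
  have hle : pairwiseScore P S S' ≤ ∑ i ∈ S', pairwiseScore P S {i} := by
    unfold pairwiseScore
    refine le_trans (card_le_card fun v hv => ?_) card_biUnion_le
    simp only [mem_filter, mem_univ, true_and, mem_biUnion] at hv ⊢
    exact h v S S' hv
  have hpos : ∃ i ∈ S', 0 < pairwiseScore P S {i} := by
    by_contra hcon
    push Not at hcon
    have : ∑ i ∈ S', pairwiseScore P S {i} = 0 :=
      sum_eq_zero fun i hi => Nat.le_zero.1 (hcon i hi)
    omega
  -- Not blocking gives a strict inequality only for members with positive score; a member of weight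
  -- and score zero satisfies none.
  set S₀ := S'.filter fun i => 0 < pairwiseScore P S {i} with hS₀
  have hsum : ∑ i ∈ S', pairwiseScore P S {i} = ∑ i ∈ S₀, pairwiseScore P S {i} := by
    rw [hS₀, sum_filter]
    refine sum_congr rfl fun i _ => ?_
    split_ifs with h
    · rfl
    · omega
  have hlt : ∀ i ∈ S₀, (pairwiseScore P S {i} : ℝ) < c * (w i / K) * n := by
    intro i hi
    by_contra hcon
    push Not at hcon
    exact hS.2 {i} (by simp) ⟨(mem_filter.1 hi).2, by simpa [weight] using hcon⟩
  have hne : S₀.Nonempty := by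
    obtain ⟨i, hi, hi'⟩ := hpos
    exact ⟨i, mem_filter.2 ⟨hi, hi'⟩⟩
  have h1 : (pairwiseScore P S S' : ℝ) < ∑ i ∈ S₀, c * (w i / K) * n := by
    calc (pairwiseScore P S S' : ℝ) ≤ ∑ i ∈ S₀, (pairwiseScore P S {i} : ℝ) := by
          rw [hsum] at hle
          exact_mod_cast hle
      _ < _ := sum_lt_sum_of_nonempty hne hlt
  have h2 : ∑ i ∈ S₀, c * (w i / K) * n ≤ ∑ i ∈ S', c * (w i / K) * n :=
    sum_le_sum_of_subset_of_nonneg (filter_subset _ _) fun i _ _ =>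
      mul_nonneg (mul_nonneg (by linarith) (div_nonneg (hw i) hK.le)) (Nat.cast_nonneg n)
  have h3 : ∑ i ∈ S', c * (w i / K) * n = c * (weight w S' / K) * n := by
    rw [weight, sum_div, mul_sum, sum_mul]
  linarith

/-- Voters compare committees by the least score among their members. -/
def ComparesByScore {n m : ℕ} (P : Preferences n m) (x : Fin n → Fin m → ℝ) : Prop :=
  ∀ v S T, P.strict v S T ↔ ∃ i ∈ S, ∀ j ∈ T, x v i < x v j

theorem ComparesByScore.singleton {n m : ℕ} {P : Preferences n m} {x : Fin n → Fin m → ℝ}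
    (h : ComparesByScore P x) (v : Fin n) (S T : Finset (Fin m)) (hs : P.strict v T S) :
    ∃ i ∈ T, P.strict v {i} S := by
  obtain ⟨i, hi, hi'⟩ := (h v T S).1 hs
  exact ⟨i, hi, (h v {i} S).2 ⟨i, by simp, hi'⟩⟩

/-- By transitivity the sets of strictly better candidates are nested; the inclusion is proper
because `i` lies in the set of `j` but not in its own. -/
theorem RankingProfile.position_lt_iff {n m : ℕ} (R : RankingProfile n m) (v : Fin n)
    (i j : Fin m) : R.position v i < R.position v j ↔ R.pref v i j ∧ ¬ R.pref v j i := by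
  classical
  have refl : ∀ k, R.pref v k k := fun k => (R.complete v k k).elim id id
  constructor
  · intro h
    have : ¬ R.pref v j i := by
      intro hji
      refine absurd h (not_lt.2 ?_)
      unfold position
      refine card_le_card fun k hk => ?_
      simp only [mem_filter, mem_univ, true_and] at hk ⊢
      exact fun hik => hk (R.transitive v j i k hji hik)
    exact ⟨(R.complete v i j).resolve_right this, this⟩
  · rintro ⟨hij, hji⟩
    unfold position
    refine card_lt_card ⟨fun k hk => ?_, fun hss => ?_⟩
    · simp only [mem_filter, mem_univ, true_and] at hk ⊢
      exact fun hjk => hk (R.transitive v i j k hij hjk)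
    · have := @hss i (by simpa using hji)
      simp only [mem_filter, mem_univ, true_and] at this
      exact this (refl i)

theorem RankingProfile.comparesByScore {n m : ℕ} (R : RankingProfile n m) :
    ComparesByScore R.preferences fun v i => (R.position v i : ℝ) := by
  intro v S T
  simp only [R.strict_iff, Nat.cast_lt, R.position_lt_iff]

theorem facilityPreferences_comparesByScore {n m : ℕ} (d : PseudoMetricSpace (Fin m ⊕ Fin n)) :
    ComparesByScore (facilityPreferences d) (voterDist d) := by
  intro v S T
  have : (facilityPreferences d).strict v S T ↔ facilityCost d v S < facilityCost d v T := by
    simp only [Preferences.strict, facilityPreferences]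
    exact lt_iff_le_not_ge.symm
  rw [this]
  unfold facilityCost
  rw [Finset.inf_lt_iff]
  refine exists_congr fun i => and_congr_right fun _ => ?_
  -- The cost of a single member is finite, which also covers an empty `T`, of cost `⊤`.
  rw [Finset.lt_inf_iff (WithTop.coe_lt_top _)]
  simp only [WithTop.coe_lt_coe]

/-! ### Averaging over pairs -/

/-- The indicator of `x < y`. -/
def lt01 (x y : ℕ) : ℝ := if x < y then 1 else 0

theorem lt01_nonneg (x y : ℕ) : 0 ≤ lt01 x y := by unfold lt01; split_ifs <;> norm_num

theorem lt01_le_one (x y : ℕ) : lt01 x y ≤ 1 := by unfold lt01; split_ifs <;> norm_num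

/-- Of the ordered pairs (j, i) and (i, j), at least one has its first entry ranked no worse than
its second; symmetrize. The `+ 1` turns `<` into `≤`. -/
theorem sum_sq_le_two_mul_sum_sum {ι : Type*} (s : Finset ι) (f : ι → ℝ) (r : ι → ℕ)
    (hf : ∀ i ∈ s, 0 ≤ f i) :
    (∑ i ∈ s, f i) ^ 2 ≤ 2 * ∑ j ∈ s, ∑ i ∈ s, f j * f i * lt01 (r j) (r i + 1) := by
  have h1 : ∑ j ∈ s, ∑ i ∈ s, f j * f i * lt01 (r j) (r i + 1) =
      ∑ j ∈ s, ∑ i ∈ s, f j * f i * lt01 (r i) (r j + 1) := by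
    rw [sum_comm]
    exact sum_congr rfl fun j _ => sum_congr rfl fun i _ => by rw [mul_comm (f i)]
  rw [two_mul]
  nth_rw 2 [h1]
  rw [sq, sum_mul_sum, ← sum_add_distrib]
  refine sum_le_sum fun j hj => ?_
  rw [← sum_add_distrib]
  refine sum_le_sum fun i hi => ?_
  have h2 : 1 ≤ lt01 (r j) (r i + 1) + lt01 (r i) (r j + 1) := by
    rcases le_total (r i) (r j) with h | h
    · have : lt01 (r i) (r j + 1) = 1 := if_pos (by omega)
      linarith [lt01_nonneg (r j) (r i + 1)]
    · have : lt01 (r j) (r i + 1) = 1 := if_pos (by omega)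
      linarith [lt01_nonneg (r i) (r j + 1)]
  nlinarith [mul_nonneg (hf j hj) (hf i hi)]

/-- The number of indices below `T` where `R` is at least as large as at `s`. -/
def upperCount (T : ℕ) (R : ℕ → ℕ) (s : ℕ) : ℕ := #{s' ∈ range T | R s < R s' + 1}

/-- A discrete form of ∫ (1 - 2u)⁺ du = 1/4 over [0, 1]. Only the set A of indices with upper count
at most T/2 contributes. Averaging over pairs inside A, twice the sum of its upper counts is at
least |A|², so the sum of deficits is at most T|A| - |A|² ≤ T²/4. -/
theorem sum_upperCount_deficit_le (T : ℕ) (R : ℕ → ℕ) :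
    4 * ∑ s ∈ range T, ((T - (upperCount T R s + upperCount T R s) : ℕ) : ℝ) ≤ (T : ℝ) ^ 2 := by
  set A := (range T).filter fun s => 2 * upperCount T R s ≤ T with hA
  have h1 : ∑ s ∈ range T, ((T - (upperCount T R s + upperCount T R s) : ℕ) : ℝ) =
      ∑ s ∈ A, ((T : ℝ) - 2 * upperCount T R s) := by
    rw [hA, sum_filter]
    refine sum_congr rfl fun s _ => ?_
    split_ifs with h
    · rw [Nat.cast_sub (by omega)]
      push_cast
      ring
    · rw [Nat.sub_eq_zero_of_le (by omega)]
      simp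
  have h2 : (#A : ℝ) ^ 2 ≤ 2 * ∑ s ∈ A, (upperCount T R s : ℝ) := by
    have := sum_sq_le_two_mul_sum_sum A (fun _ => 1) R (fun _ _ => zero_le_one)
    simp only [sum_const, nsmul_eq_mul, mul_one, one_mul] at this
    refine this.trans ?_
    gcongr with s hs
    unfold upperCount lt01
    rw [Finset.sum_boole]
    exact_mod_cast card_le_card (filter_subset_filter _ (filter_subset _ _))
  rw [h1, sum_sub_distrib, sum_const, nsmul_eq_mul, ← mul_sum]
  nlinarith [sq_nonneg ((T : ℝ) - 2 * #A)]

/-! ### The greedy response -/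

/-- The total weight, over voters and candidates, of the candidates which beat the committee. -/
def uncovered (n m : ℕ) (z q : ℕ → ℝ) (r : ℕ → ℕ → ℕ) (R : ℕ → ℕ) : ℝ :=
  ∑ v ∈ range n, ∑ i ∈ range m, z v * q i * lt01 (r v i) (R v)

/-- The decrease of `uncovered` when candidate `j` joins the committee. -/
def gain (n m : ℕ) (z q : ℕ → ℝ) (r : ℕ → ℕ → ℕ) (R : ℕ → ℕ) (j : ℕ) : ℝ :=
  ∑ v ∈ range n, ∑ i ∈ range m, z v * q i * lt01 (r v j) (r v i + 1) * lt01 (r v i) (R v)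

section Greedy

variable {n m : ℕ} {z q w : ℕ → ℝ} {r : ℕ → ℕ → ℕ} {R : ℕ → ℕ}

/-- With truncated subtraction, `R v - (R v - r v j)` is the minimum of `R v` and `r v j`. The pair
(v, i) leaves the sum exactly when `r v j ≤ r v i < R v`. -/
theorem uncovered_sub_gain (j : ℕ) :
    uncovered n m z q r (fun v => R v - (R v - r v j)) =
      uncovered n m z q r R - gain n m z q r R j := by
  simp only [uncovered, gain, ← sum_sub_distrib]
  refine sum_congr rfl fun v _ => sum_congr rfl fun i _ => ?_
  have : lt01 (r v i) (R v - (R v - r v j)) =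
      lt01 (r v i) (R v) - lt01 (r v j) (r v i + 1) * lt01 (r v i) (R v) := by
    unfold lt01
    split_ifs <;> first | omega | norm_num
  rw [this]
  ring

theorem gain_nonneg (hz : ∀ v < n, 0 ≤ z v) (hq : ∀ i < m, 0 ≤ q i) (j : ℕ) :
    0 ≤ gain n m z q r R j :=
  sum_nonneg fun v hv => sum_nonneg fun i hi =>
    mul_nonneg (mul_nonneg (mul_nonneg (hz v (mem_range.1 hv)) (hq i (mem_range.1 hi)))
      (lt01_nonneg _ _)) (lt01_nonneg _ _)

theorem uncovered_nonneg (hz : ∀ v < n, 0 ≤ z v) (hq : ∀ i < m, 0 ≤ q i) :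
    0 ≤ uncovered n m z q r R :=
  sum_nonneg fun v hv => sum_nonneg fun i hi =>
    mul_nonneg (mul_nonneg (hz v (mem_range.1 hv)) (hq i (mem_range.1 hi))) (lt01_nonneg _ _)

/-- Let u_v be the mass under q of the candidates that beat the committee for v. Cauchy–Schwarz
bounds the square by Z Σ z_v u_v², and averaging over pairs shows that a candidate drawn from q
covers at least u_v²/2 for voter v. -/
theorem uncovered_sq_le (hz : ∀ v < n, 0 ≤ z v) (hq : ∀ i < m, 0 ≤ q i) :
    uncovered n m z q r R ^ 2 ≤
      2 * (∑ v ∈ range n, z v) * ∑ j ∈ range m, q j * gain n m z q r R j := by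
  set u : ℕ → ℝ := fun v => ∑ i ∈ range m, q i * lt01 (r v i) (R v) with hu
  have h1 : uncovered n m z q r R = ∑ v ∈ range n, z v * u v := by
    simp only [uncovered, hu, mul_sum, mul_assoc]
  have h2 : (∑ v ∈ range n, z v * u v) ^ 2 ≤
      (∑ v ∈ range n, z v) * ∑ v ∈ range n, z v * u v ^ 2 :=
    sum_sq_le_sum_mul_sum_of_sq_le_mul _ (fun v hv => hz v (mem_range.1 hv))
      (fun v hv => mul_nonneg (hz v (mem_range.1 hv)) (sq_nonneg _)) fun v _ => by
        rw [mul_pow, sq (z v), mul_assoc]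
  have h3 : ∑ v ∈ range n, z v * u v ^ 2 ≤ 2 * ∑ j ∈ range m, q j * gain n m z q r R j := by
    have h4 : ∑ j ∈ range m, q j * gain n m z q r R j = ∑ v ∈ range n, z v *
        ∑ j ∈ range m, ∑ i ∈ range m,
          q j * (q i * lt01 (r v j) (r v i + 1) * lt01 (r v i) (R v)) := by
      simp only [gain, mul_sum]
      rw [sum_comm]
      exact sum_congr rfl fun v _ => sum_congr rfl fun j _ => sum_congr rfl fun i _ => by ring
    rw [h4, mul_sum]
    refine sum_le_sum fun v hv => ?_
    have h5 := sum_sq_le_two_mul_sum_sum (range m) (fun i => q i * lt01 (r v i) (R v)) (r v)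
      fun i hi => mul_nonneg (hq i (mem_range.1 hi)) (lt01_nonneg _ _)
    have h6 : ∑ j ∈ range m, ∑ i ∈ range m, q j * lt01 (r v j) (R v) *
          (q i * lt01 (r v i) (R v)) * lt01 (r v j) (r v i + 1) ≤
        ∑ j ∈ range m, ∑ i ∈ range m,
          q j * (q i * lt01 (r v j) (r v i + 1) * lt01 (r v i) (R v)) := by
      refine sum_le_sum fun j hj => sum_le_sum fun i hi => ?_
      have h7 : 0 ≤ q j * (q i * lt01 (r v j) (r v i + 1) * lt01 (r v i) (R v)) :=
        mul_nonneg (hq j (mem_range.1 hj)) (mul_nonneg (mul_nonneg (hq i (mem_range.1 hi))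
          (lt01_nonneg _ _)) (lt01_nonneg _ _))
      nlinarith [lt01_le_one (r v j) (R v)]
    have h8 : u v ^ 2 ≤ 2 * ∑ j ∈ range m, ∑ i ∈ range m,
        q j * (q i * lt01 (r v j) (r v i + 1) * lt01 (r v i) (R v)) := by
      simp only [hu]
      linarith
    nlinarith [hz v (mem_range.1 hv)]
  rw [h1]
  refine h2.trans ?_
  rw [mul_comm 2, mul_assoc]
  exact mul_le_mul_of_nonneg_left h3 (sum_nonneg fun v hv => hz v (mem_range.1 hv))

/-- Otherwise the `q`-average of the reversed inequalities contradicts `uncovered_sq_le`. Positivity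
of `q j` makes the candidate relevant when `q` vanishes elsewhere. -/
theorem exists_gain_ge (hz : ∀ v < n, 0 ≤ z v) (hq : ∀ i < m, 0 ≤ q i)
    (hw : ∀ i < m, 0 ≤ w i) (hpos : ∃ i < m, 0 < q i) :
    ∃ j < m, 0 < q j ∧ w j * uncovered n m z q r R ^ 2 ≤
      2 * (∑ v ∈ range n, z v) * (∑ i ∈ range m, q i * w i) * gain n m z q r R j := by
  by_contra! hcon
  set U := uncovered n m z q r R
  set W := ∑ i ∈ range m, q i * w i with hW
  set Z := ∑ v ∈ range n, z v
  have h1 : ∑ j ∈ range m, q j * (2 * Z * W * gain n m z q r R j) <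
      ∑ j ∈ range m, q j * (w j * U ^ 2) := by
    refine sum_lt_sum (fun j hj => ?_) ?_
    · rcases (hq j (mem_range.1 hj)).eq_or_lt with h | h
      · simp [← h]
      · exact mul_le_mul_of_nonneg_left (hcon j (mem_range.1 hj) h).le h.le
    · obtain ⟨i, hi, hi'⟩ := hpos
      exact ⟨i, mem_range.2 hi, mul_lt_mul_of_pos_left (hcon i hi hi') hi'⟩
  have h2 : ∑ j ∈ range m, q j * (w j * U ^ 2) = W * U ^ 2 := by
    rw [hW, sum_mul]
    exact sum_congr rfl fun _ _ => by ring
  have h3 : ∑ j ∈ range m, q j * (2 * Z * W * gain n m z q r R j) =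
      W * (2 * Z * ∑ j ∈ range m, q j * gain n m z q r R j) := by
    have : ∀ j, q j * (2 * Z * W * gain n m z q r R j) =
        W * (2 * Z) * (q j * gain n m z q r R j) := fun j => by ring
    simp only [this]
    rw [← mul_sum, mul_assoc]
  have h4 : 0 ≤ W := sum_nonneg fun i hi =>
    mul_nonneg (hq i (mem_range.1 hi)) (hw i (mem_range.1 hi))
  have h5 := mul_le_mul_of_nonneg_left (uncovered_sq_le (r := r) (R := R) hz hq) h4
  rw [h2, h3] at h1
  exact absurd h1 (not_lt.2 h5)

/-- For U > 0, the hypotheses give W ≤ C/U and w ≤ Cg/U², so the product is at most C(1 - g/U)(1 +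
g/U) ≤ C. -/
theorem greedy_potential_step {U g W w C : ℝ} (hg0 : 0 ≤ g) (hgU : g ≤ U)
    (hw : 0 ≤ w) (h : U * W ≤ C) (hgood : w * U ^ 2 ≤ C * g) : (U - g) * (W + w) ≤ C := by
  rcases (hg0.trans hgU).eq_or_lt with hU | hU
  · have : g = 0 := by linarith
    subst this
    rw [← hU] at h ⊢
    simpa using h
  · have h1 : U * ((U - g) * (W + w)) ≤ U * C := by
      have h2 : (U - g) * (U * (U * W)) ≤ (U - g) * (U * C) :=
        mul_le_mul_of_nonneg_left (mul_le_mul_of_nonneg_left h hU.le) (by linarith)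
      have h3 : (U - g) * (w * U ^ 2) ≤ (U - g) * (C * g) :=
        mul_le_mul_of_nonneg_left hgood (by linarith)
      by_contra! hcon
      have h4 := mul_lt_mul_of_pos_left hcon hU
      have hC : 0 ≤ C * g := le_trans (by positivity) hgood
      nlinarith [mul_nonneg hC hg0]
    exact le_of_mul_le_mul_left h1 hU

end Greedy

/-- An election with `n` voters and `m` candidates: `r v i` is the rank of candidate `i` for
voter `v`, `w` are the weights and `K` is the weight limit. -/
structure Election where
  n : ℕ
  m : ℕ
  r : ℕ → ℕ → ℕ
  w : ℕ → ℝ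
  K : ℝ

namespace Election

structure Valid (E : Election) : Prop where
  rank_lt : ∀ v < E.n, ∀ i < E.m, E.r v i < E.m
  weight_nonneg : ∀ i < E.m, 0 ≤ E.w i
  limit_pos : 0 < E.K

variable (E : Election)

/-- The weight of the candidate exceeds `K / (16 m)`. The other candidates together weigh at most
`K / 16`, and all of them are selected at the start. -/
def Large (i : ℕ) : Prop := E.K < 16 * E.m * E.w i

/-- The candidates which are used in a stage with budget `κ`. -/
def Relevant (κ : ℝ) (i : ℕ) : Prop := E.Large i ∧ ¬ κ < 3 * E.w i

/-- The total weight of the voters who prefer candidate `i` to a committee of rank `R`. -/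
def score (z : ℕ → ℝ) (R : ℕ → ℕ) (i : ℕ) : ℝ := ∑ v ∈ range E.n, z v * lt01 (E.r v i) (R v)

/-- `R` is, for every voter, the rank of some member of `L`, or `m`. -/
def Attained (L R : ℕ → ℕ) : Prop :=
  ∀ v < E.n, R v = E.m ∨ ∃ j < E.m, 0 < L j ∧ E.r v j = R v

def committeeWeight (L : ℕ → ℕ) : ℝ := ∑ i ∈ range E.m, if 0 < L i then E.w i else 0

variable {E}

theorem score_nonneg {z : ℕ → ℝ} (hz : ∀ v < E.n, 0 ≤ z v) (R : ℕ → ℕ) (i : ℕ) :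
    0 ≤ E.score z R i :=
  sum_nonneg fun v hv => mul_nonneg (hz v (mem_range.1 hv)) (lt01_nonneg _ _)

theorem score_le {z : ℕ → ℝ} (hz : ∀ v < E.n, 0 ≤ z v) (R : ℕ → ℕ) (i : ℕ) :
    E.score z R i ≤ ∑ v ∈ range E.n, z v :=
  sum_le_sum fun v hv => mul_le_of_le_one_right (hz v (mem_range.1 hv)) (lt01_le_one _ _)

theorem uncovered_eq (z q : ℕ → ℝ) (R : ℕ → ℕ) :
    uncovered E.n E.m z q E.r R = ∑ i ∈ range E.m, q i * E.score z R i := by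
  simp only [uncovered, score, mul_sum]
  rw [sum_comm]
  exact sum_congr rfl fun i _ => sum_congr rfl fun v _ => by ring

/-! ### The greedy response -/

/-- Candidate `j` covers enough for its weight. -/
def Good (E : Election) (z q : ℕ → ℝ) (R : ℕ → ℕ) (j : ℕ) : Prop :=
  E.w j * uncovered E.n E.m z q E.r R ^ 2 ≤
    2 * (∑ v ∈ range E.n, z v) * (∑ i ∈ range E.m, q i * E.w i) * gain E.n E.m z q E.r R j

/-- `W` is the weight spent, where a candidate added twice counts twice. By `progress`, either two
thirds of the budget are spent, or every step so far has added a candidate heavier than K/(16m), or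
there is nothing to cover. -/
structure GreedyInv (E : Election) (z q : ℕ → ℝ) (κ : ℝ) (k : ℕ) (L R : ℕ → ℕ) (W : ℝ) :
    Prop where
  nonneg : 0 ≤ W
  le_budget : W ≤ κ
  weight_le : E.committeeWeight L ≤ W
  attained : E.Attained L R
  potential : uncovered E.n E.m z q E.r R * W ≤
    2 * (∑ v ∈ range E.n, z v) * ∑ i ∈ range E.m, q i * E.w i
  progress : 2 * κ < 3 * W ∨ k * E.K ≤ 16 * E.m * W ∨ ∀ i < E.m, q i = 0

structure StageData (E : Election) (z : ℕ → ℝ) (κ : ℝ) : Prop where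
  valid : E.Valid
  nonneg : ∀ v < E.n, 0 ≤ z v
  budget_pos : 0 < κ
  budget_le : 2 * κ ≤ E.K

theorem gain_le {z q : ℕ → ℝ} {R : ℕ → ℕ} (hz : ∀ v < E.n, 0 ≤ z v) (hq : ∀ i < E.m, 0 ≤ q i)
    (j : ℕ) : gain E.n E.m z q E.r R j ≤ uncovered E.n E.m z q E.r R := by
  have := uncovered_sub_gain (n := E.n) (m := E.m) (z := z) (q := q) (r := E.r) (R := R) j
  have h := uncovered_nonneg (r := E.r) (R := fun v => R v - (R v - E.r v j)) hz hq
  linarith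

theorem GreedyInv.zero {z q : ℕ → ℝ} {κ : ℝ} {L R : ℕ → ℕ} (hd : StageData E z κ)
    (hq : ∀ i < E.m, 0 ≤ q i) (hL : ∀ i < E.m, L i = 0) (hR : ∀ v < E.n, R v = E.m) :
    GreedyInv E z q κ 0 L R 0 where
  nonneg := le_rfl
  le_budget := hd.budget_pos.le
  weight_le := by
    refine (sum_eq_zero fun i hi => ?_).le
    simp [hL i (mem_range.1 hi)]
  attained v hv := .inl (hR v hv)
  potential := by
    rw [mul_zero]
    exact mul_nonneg (mul_nonneg zero_le_two (sum_nonneg fun v hv => hd.nonneg v (mem_range.1 hv)))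
      (sum_nonneg fun i hi => mul_nonneg (hq i (mem_range.1 hi))
        (hd.valid.weight_nonneg i (mem_range.1 hi)))
  progress := by simp

/-- By `exists_gain_ge`, a search among the relevant candidates fails only if `q` vanishes. -/
theorem GreedyInv.skip {z q : ℕ → ℝ} {κ W : ℝ} {k : ℕ} {L R : ℕ → ℕ} (hd : StageData E z κ)
    (hq : ∀ i < E.m, 0 ≤ q i) (hrel : ∀ i < E.m, ¬ E.Relevant κ i → q i = 0)
    (h : GreedyInv E z q κ k L R W)
    (hs : 2 * κ < 3 * W ∨ ∀ j < E.m, E.Relevant κ j → ¬ E.Good z q R j) :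
    GreedyInv E z q κ (k + 1) L R W := by
  refine { h with progress := hs.imp_right fun hs => .inr fun i hi => ?_ }
  by_contra hcon
  obtain ⟨j, hj, hqj, hg⟩ := exists_gain_ge (r := E.r) (R := R) hd.nonneg hq
    hd.valid.weight_nonneg ⟨i, hi, lt_of_le_of_ne (hq i hi) (Ne.symm hcon)⟩
  refine hs j hj ?_ hg
  by_contra hj'
  exact hqj.ne' (hrel j hj hj')

theorem uncovered_congr {n m : ℕ} {z q : ℕ → ℝ} {r : ℕ → ℕ → ℕ} {R R' : ℕ → ℕ}
    (h : ∀ v < n, R v = R' v) : uncovered n m z q r R = uncovered n m z q r R' :=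
  sum_congr rfl fun v hv => by rw [h v (mem_range.1 hv)]

theorem GreedyInv.add {z q : ℕ → ℝ} {κ W : ℝ} {k j : ℕ} {L R L' R' : ℕ → ℕ}
    (hd : StageData E z κ) (hq : ∀ i < E.m, 0 ≤ q i) (h : GreedyInv E z q κ k L R W) (hj : j < E.m)
    (hrel : E.Relevant κ j) (hg : E.Good z q R j) (hW : ¬ 2 * κ < 3 * W)
    (hL' : ∀ i, L' i = if i = j then 1 else L i)
    (hR' : ∀ v < E.n, R' v = R v - (R v - E.r v j)) :
    GreedyInv E z q κ (k + 1) L' R' (W + E.w j) where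
  nonneg := add_nonneg h.nonneg (hd.valid.weight_nonneg j hj)
  -- At most 2κ/3 has been spent, and a relevant candidate weighs at most κ/3.
  le_budget := by
    have := hrel.2
    linarith
  weight_le := by
    have h1 : E.committeeWeight L' ≤
        E.committeeWeight L + ∑ i ∈ range E.m, if i = j then E.w i else 0 := by
      unfold committeeWeight
      rw [← sum_add_distrib]
      refine sum_le_sum fun i hi => ?_
      have := hd.valid.weight_nonneg i (mem_range.1 hi)
      rw [hL']
      split_ifs <;> first | omega | linarith
    rw [sum_ite_eq' (range E.m) j, if_pos (mem_range.2 hj)] at h1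
    linarith [h.weight_le]
  attained v hv := by
    rw [hR' v hv]
    rcases le_total (R v) (E.r v j) with hle | hle
    · rw [Nat.sub_eq_zero_of_le hle, Nat.sub_zero]
      refine (h.attained v hv).imp_right ?_
      rintro ⟨i, hi, hLi, he⟩
      refine ⟨i, hi, ?_, he⟩
      rw [hL']
      split_ifs <;> omega
    · exact .inr ⟨j, hj, by simp [hL'], by omega⟩
  potential := by
    rw [uncovered_congr hR', uncovered_sub_gain]
    exact greedy_potential_step (gain_nonneg hd.nonneg hq j) (gain_le hd.nonneg hq j)
      (hd.valid.weight_nonneg j hj) h.potential hg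
  progress := by
    rcases h.progress with hp | hp | hp
    · exact absurd hp hW
    · refine .inr (.inl ?_)
      have := hrel.1
      unfold Large at this
      push_cast
      linarith
    · exact .inr (.inr hp)

/-- Once W ≥ 2κ/3, dividing the potential bound by W turns the factor 2 into 3/κ. With 16m additions
the weight spent would reach K, more than enough. -/
theorem GreedyInv.uncovered_le {z q : ℕ → ℝ} {κ W : ℝ} {L R : ℕ → ℕ} (hd : StageData E z κ)
    (hq : ∀ i < E.m, 0 ≤ q i) (h : GreedyInv E z q κ (16 * E.m) L R W) :
    uncovered E.n E.m z q E.r R ≤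
      3 * (∑ v ∈ range E.n, z v) / κ * ∑ i ∈ range E.m, q i * E.w i := by
  have hκ := hd.budget_pos
  by_cases h0 : ∀ i < E.m, q i = 0
  · have h1 : uncovered E.n E.m z q E.r R = 0 :=
      sum_eq_zero fun v _ => sum_eq_zero fun i hi => by simp [h0 i (mem_range.1 hi)]
    have h2 : ∑ i ∈ range E.m, q i * E.w i = 0 :=
      sum_eq_zero fun i hi => by simp [h0 i (mem_range.1 hi)]
    rw [h1, h2, mul_zero]
  · have hm : 0 < (E.m : ℝ) := by
      push Not at h0
      obtain ⟨i, hi, -⟩ := h0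
      exact_mod_cast (Nat.zero_le i).trans_lt hi
    have hW : 2 * κ ≤ 3 * W := by
      rcases h.progress with hp | hp | hp
      · exact hp.le
      · push_cast at hp
        have : E.K ≤ W := le_of_mul_le_mul_left hp (by positivity)
        linarith [hd.budget_le]
      · exact absurd hp h0
    have hU := uncovered_nonneg (r := E.r) (R := R) hd.nonneg hq
    have h1 := h.potential
    rw [div_mul_eq_mul_div, le_div_iff₀ hκ]
    nlinarith [mul_le_mul_of_nonneg_left hW hU]

/-! ### The rounds of a stage -/

/-- `A i` accumulates the excess of the score of `i` over its target 3Z w_i/κ, truncated at zero,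
and serves as the weight of `i` in the next round. A linear bound on Σ A_i² makes the average excess
vanish. -/
structure RoundInv (E : Election) (z : ℕ → ℝ) (κ : ℝ) (k : ℕ) (L R : ℕ → ℕ → ℕ) (A : ℕ → ℝ) :
    Prop where
  weight_le : ∀ s < k, E.committeeWeight (L s) ≤ κ
  attained : ∀ s < k, E.Attained (L s) (R s)
  nonneg : ∀ i < E.m, 0 ≤ A i
  eq_zero : ∀ i < E.m, ¬ E.Relevant κ i → A i = 0
  sum_le : ∀ i < E.m, E.Relevant κ i →
    ∑ s ∈ range k, E.score z (R s) i ≤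
      k * (3 * (∑ v ∈ range E.n, z v) / κ * E.w i) + A i
  sum_sq_le : ∑ i ∈ range E.m, A i ^ 2 ≤ k * (E.m * (∑ v ∈ range E.n, z v) ^ 2)

theorem RoundInv.zero {z : ℕ → ℝ} {κ : ℝ} {L R : ℕ → ℕ → ℕ} {A : ℕ → ℝ}
    (hA : ∀ i < E.m, A i = 0) : RoundInv E z κ 0 L R A where
  weight_le := by simp
  attained := by simp
  nonneg i hi := (hA i hi).ge
  eq_zero i hi _ := hA i hi
  sum_le i hi _ := by simp [hA i hi]
  sum_sq_le := by
    rw [sum_eq_zero fun i hi => by rw [hA i (mem_range.1 hi)]; ring]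
    simp

open Classical in
theorem RoundInv.succ {z : ℕ → ℝ} {κ W : ℝ} {k : ℕ} {L R L' R' : ℕ → ℕ → ℕ} {A A' : ℕ → ℝ}
    (hd : StageData E z κ) (h : RoundInv E z κ k L R A)
    (hL : ∀ s < k, L' s = L s) (hR : ∀ s < k, R' s = R s)
    (hG : GreedyInv E z A κ (16 * E.m) (L' k) (R' k) W)
    (hA' : ∀ i < E.m, A' i = if E.Relevant κ i then
      max (A i + (E.score z (R' k) i - 3 * (∑ v ∈ range E.n, z v) / κ * E.w i)) 0 else A i) :
    RoundInv E z κ (k + 1) L' R' A' where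
  weight_le s hs := by
    rcases Nat.lt_succ_iff_lt_or_eq.1 hs with hs | rfl
    · rw [hL s hs]
      exact h.weight_le s hs
    · exact hG.weight_le.trans hG.le_budget
  attained s hs := by
    rcases Nat.lt_succ_iff_lt_or_eq.1 hs with hs | rfl
    · rw [hL s hs, hR s hs]
      exact h.attained s hs
    · exact hG.attained
  nonneg i hi := by
    rw [hA' i hi]
    split_ifs
    · exact le_max_right _ _
    · exact h.nonneg i hi
  eq_zero i hi hr := by
    rw [hA' i hi, if_neg hr]
    exact h.eq_zero i hi hr
  sum_le i hi hr := by
    have h1 : ∑ s ∈ range k, E.score z (R' s) i = ∑ s ∈ range k, E.score z (R s) i :=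
      sum_congr rfl fun s hs => by rw [hR s (mem_range.1 hs)]
    rw [sum_range_succ, h1, hA' i hi, if_pos hr]
    have h2 := h.sum_le i hi hr
    have h3 := le_max_left
      (A i + (E.score z (R' k) i - 3 * (∑ v ∈ range E.n, z v) / κ * E.w i)) 0
    push_cast
    linarith
  sum_sq_le := by
    have hZ : 0 ≤ ∑ v ∈ range E.n, z v := sum_nonneg fun v hv => hd.nonneg v (mem_range.1 hv)
    set Z := ∑ v ∈ range E.n, z v with hZdef
    have h1 : ∀ i ∈ range E.m, A' i ^ 2 ≤
        A i ^ 2 + 2 * (A i * E.score z (R' k) i - 3 * Z / κ * (A i * E.w i)) + Z ^ 2 := by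
      intro i hi
      have hi := mem_range.1 hi
      rw [hA' i hi]
      split_ifs with hr
      · have h2 := score_nonneg hd.nonneg (R' k) i
        have h3 := score_le hd.nonneg (R' k) i
        have h4 : 0 ≤ 3 * Z / κ * E.w i := mul_nonneg
          (div_nonneg (by linarith) hd.budget_pos.le) (hd.valid.weight_nonneg i hi)
        -- Relevance means 3 w_i ≤ κ, so score and target both lie in [0, Z] and the increment g
        -- satisfies g² ≤ Z².
        have h5 : 3 * Z / κ * E.w i ≤ Z := by
          rw [div_mul_eq_mul_div, div_le_iff₀ hd.budget_pos]
          nlinarith [hr.2]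
        set g := E.score z (R' k) i - 3 * Z / κ * E.w i with hg
        have h6 : max (A i + g) 0 ^ 2 ≤ (A i + g) ^ 2 := by
          rcases max_choice (A i + g) 0 with h | h <;> rw [h]
          nlinarith [sq_nonneg (A i + g)]
        have h7 : g ^ 2 ≤ Z ^ 2 := sq_le_sq' (by linarith) (by linarith)
        have h8 : A i * E.score z (R' k) i - 3 * Z / κ * (A i * E.w i) = A i * g := by
          rw [hg]
          ring
        rw [h8]
        nlinarith
      · rw [h.eq_zero i hi hr]
        nlinarith [sq_nonneg Z]
    have h2 := sum_le_sum h1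
    rw [sum_add_distrib, sum_add_distrib, ← mul_sum, sum_sub_distrib, ← mul_sum, sum_const,
      card_range, nsmul_eq_mul, ← uncovered_eq] at h2
    -- The greedy committee answers the weights A, so the cross term Σ A_i g_i is not positive and
    -- only the terms Z² remain.
    have h3 := hG.uncovered_le hd h.nonneg
    have h4 := h.sum_sq_le
    push_cast
    linarith

theorem RoundInv.sum_score_le {z : ℕ → ℝ} {κ : ℝ} {T : ℕ} {L R : ℕ → ℕ → ℕ} {A : ℕ → ℝ}
    (hd : StageData E z κ) (hT : T = 1 + 2048 * E.m ^ 3) (h : RoundInv E z κ T L R A)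
    {i : ℕ} (hi : i < E.m) (hlarge : E.Large i) :
    ∑ s ∈ range T, E.score z (R s) i ≤
      T * (51 / 16 * (E.w i * (∑ v ∈ range E.n, z v) / κ)) := by
  have hZ : 0 ≤ ∑ v ∈ range E.n, z v := sum_nonneg fun v hv => hd.nonneg v (mem_range.1 hv)
  have hκ := hd.budget_pos
  have hw := hd.valid.weight_nonneg i hi
  by_cases hr : E.Relevant κ i
  · have h1 := h.sum_le i hi hr
    set Z := ∑ v ∈ range E.n, z v with hZdef
    have h2 : A i ^ 2 ≤ T * (E.m * Z ^ 2) :=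
      (single_le_sum (f := fun i => A i ^ 2) (fun _ _ => sq_nonneg _) (mem_range.2 hi)).trans
        h.sum_sq_le
    have hm : 0 < (E.m : ℝ) := by exact_mod_cast (Nat.zero_le i).trans_lt hi
    have hT' : 2048 * (E.m : ℝ) ^ 3 ≤ T := by
      rw [hT]
      push_cast
      linarith
    have hTpos : 0 < (T : ℝ) := lt_of_lt_of_le (by positivity) hT'
    -- The error term in 51/16 = 3 + 3/16. Since i is large and 2κ ≤ K, w_i/κ is at least 1/(8m), so
    -- an error of 3Z/(128m) per round suffices; T ≥ 2048 m³ provides it because 9 · 2048 ≥ 16384.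
    have h3 : A i ≤ T * (3 / 16 * (E.w i * Z / κ)) := by
      have h4 : 2 ≤ 16 * E.m * (E.w i / κ) := by
        rw [← mul_div_assoc, le_div_iff₀ hκ]
        have := hlarge
        unfold Large at this
        linarith [hd.budget_le]
      have h5 : A i ≤ T * (3 / (128 * E.m) * Z) := by
        refine le_of_sq_le_sq ?_ (by positivity)
        refine h2.trans ?_
        have h6 : (T * (3 / (128 * E.m) * Z)) ^ 2 = T * (9 / 16384 * T / E.m ^ 2 * Z ^ 2) := by
          field_simp
          ring
        rw [h6]
        refine mul_le_mul_of_nonneg_left (mul_le_mul_of_nonneg_right ?_ (sq_nonneg Z)) hTpos.le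
        rw [le_div_iff₀ (by positivity)]
        nlinarith [pow_pos hm 3]
      refine h5.trans (mul_le_mul_of_nonneg_left ?_ hTpos.le)
      rw [mul_comm (E.w i) Z, mul_div_assoc, mul_comm Z, ← mul_assoc]
      refine mul_le_mul_of_nonneg_right ?_ hZ
      rw [div_le_iff₀ (by positivity)]
      nlinarith
    have h4 : (T : ℝ) * (3 * Z / κ * E.w i) = T * (3 * (E.w i * Z / κ)) := by ring
    linarith
  -- A candidate too heavy for the budget meets its target trivially, as its score never exceeds Z.
  · have h1 : κ < 3 * E.w i := by
      by_contra hcon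
      exact hr ⟨hlarge, hcon⟩
    have h2 : ∑ s ∈ range T, E.score z (R s) i ≤ T * ∑ v ∈ range E.n, z v := by
      refine (sum_le_sum fun s _ => score_le hd.nonneg (R s) i).trans ?_
      simp
    refine h2.trans (mul_le_mul_of_nonneg_left ?_ (Nat.cast_nonneg T))
    rw [← mul_div_assoc, le_div_iff₀ hκ]
    nlinarith

/-! ### The stages -/

/-- The voters who prefer candidate `i` to the committee `S`. -/
def dissenters (E : Election) (S : ℕ → ℕ) (i : ℕ) : Finset ℕ :=
  {v ∈ range E.n | ∀ j < E.m, 0 < S j → E.r v i < E.r v j}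

/-- The term 2κ in `weight_le` reserves the budgets κ + κ/2 + κ/4 + ⋯ of all remaining stages. `1 -
z v` is the weight that voter v has lost; `sum_dissenters_le` charges the losses of the dissenters
to the candidate they prefer. -/
structure StageInv (E : Election) (t : ℕ) (S : ℕ → ℕ) (z : ℕ → ℝ) (κ : ℝ) : Prop where
  budget : κ = 15 * E.K / 32 * (1 / 2) ^ t
  weight_le : E.committeeWeight S + 2 * κ ≤ E.K
  nonneg : ∀ v < E.n, 0 ≤ z v
  le_one : ∀ v < E.n, z v ≤ 1
  sum_le : ∑ v ∈ range E.n, z v ≤ E.n * (1 / 4) ^ t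
  small : ∀ i < E.m, ¬ E.Large i → 0 < S i
  mem_le_one : ∀ i < E.m, S i ≤ 1
  sum_dissenters_le : ∀ i < E.m, E.Large i →
    ∑ v ∈ E.dissenters S i, (1 - z v) ≤ 136 / 5 * (E.w i * E.n / E.K) * (1 - (1 / 2) ^ t)

theorem StageInv.stageData {t : ℕ} {S : ℕ → ℕ} {z : ℕ → ℝ} {κ : ℝ} (hE : E.Valid)
    (h : StageInv E t S z κ) : StageData E z κ where
  valid := hE
  nonneg := h.nonneg
  budget_pos := by
    have := hE.limit_pos
    rw [h.budget]
    positivity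
  budget_le := by
    have h1 : 0 ≤ E.committeeWeight S := sum_nonneg fun i hi => by
      have := hE.weight_nonneg i (mem_range.1 hi)
      split_ifs <;> simp [this]
    linarith [h.weight_le]

theorem StageInv.zero {S : ℕ → ℕ} {z : ℕ → ℝ} {κ : ℝ} (hE : E.Valid) (hκ : κ = 15 * E.K / 32)
    (hz : ∀ v < E.n, z v = 1) (hS : ∀ i < E.m, 0 < S i ↔ ¬ E.Large i)
    (hS' : ∀ i < E.m, S i ≤ 1) : StageInv E 0 S z κ where
  budget := by simp [hκ]
  weight_le := by
    -- The initial budget 15K/32 is chosen so that K/16 + 2 · 15K/32 = K.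
    have h1 : E.committeeWeight S ≤ E.K / 16 := by
      rcases Nat.eq_zero_or_pos E.m with hm | hm
      · have := hE.limit_pos
        simp only [committeeWeight, hm, range_zero, sum_empty]
        positivity
      · have hm' : 0 < (E.m : ℝ) := by exact_mod_cast hm
        have h2 : ∀ i ∈ range E.m, (if 0 < S i then E.w i else 0) ≤ E.K / 16 / E.m := by
          intro i hi
          split_ifs with h
          · have := (hS i (mem_range.1 hi)).1 h
            unfold Large at this
            rw [le_div_iff₀ hm', le_div_iff₀ (by norm_num)]
            linarith
          · have := hE.limit_pos
            positivity
        refine (sum_le_sum h2).trans (le_of_eq ?_)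
        rw [sum_const, card_range, nsmul_eq_mul]
        field_simp
    rw [hκ]
    linarith
  nonneg v hv := by simp [hz v hv]
  le_one v hv := by simp [hz v hv]
  sum_le := by
    rw [sum_congr rfl fun v hv => hz v (mem_range.1 hv)]
    simp
  small i hi h := (hS i hi).2 h
  mem_le_one := hS'
  sum_dissenters_le i hi _ := by
    rw [sum_eq_zero fun v hv => ?_]
    · simp
    · rw [hz v (mem_range.1 (mem_filter.1 hv).1), sub_self]

/-- The factor by which the weight of a voter decreases when the committee with rank `R b v` is
selected, multiplied by `T`. -/
def deficit (T : ℕ) (R : ℕ → ℕ → ℕ) (b v : ℕ) : ℕ :=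
  T - (upperCount T (fun s => R s v) b + upperCount T (fun s => R s v) b)

/-- For each voter the deficit averages at most T/4 over a uniformly random committee of the
lottery, so some committee achieves this for the weighted sum over voters. -/
theorem exists_deficit_le {z : ℕ → ℝ} (hz : ∀ v < E.n, 0 ≤ z v) {T : ℕ} (hT : 0 < T)
    (R : ℕ → ℕ → ℕ) : ∃ b < T, 4 * ∑ v ∈ range E.n, z v * deficit T R b v ≤
      (∑ v ∈ range E.n, z v) * T := by
  by_contra! hcon
  have h1 : ∑ b ∈ range T, (∑ v ∈ range E.n, z v) * (T : ℝ) <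
      ∑ b ∈ range T, 4 * ∑ v ∈ range E.n, z v * deficit T R b v :=
    sum_lt_sum_of_nonempty ⟨0, mem_range.2 hT⟩ fun b hb => hcon b (mem_range.1 hb)
  have h2 : ∑ b ∈ range T, 4 * ∑ v ∈ range E.n, z v * (deficit T R b v : ℝ) =
      ∑ v ∈ range E.n, z v * (4 * ∑ b ∈ range T, (deficit T R b v : ℝ)) := by
    simp only [mul_sum]
    rw [sum_comm]
    exact sum_congr rfl fun v _ => sum_congr rfl fun b _ => by ring
  have h3 : ∑ v ∈ range E.n, z v * (4 * ∑ b ∈ range T, (deficit T R b v : ℝ)) ≤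
      ∑ v ∈ range E.n, z v * (T : ℝ) ^ 2 :=
    sum_le_sum fun v hv => mul_le_mul_of_nonneg_left
      (sum_upperCount_deficit_le T fun s => R s v) (hz v (mem_range.1 hv))
  rw [h2, sum_const, card_range, nsmul_eq_mul] at h1
  rw [← sum_mul] at h3
  linarith

theorem StageInv.succ {t T b : ℕ} {S S' : ℕ → ℕ} {z z' A : ℕ → ℝ} {κ κ' : ℝ} {L R : ℕ → ℕ → ℕ}
    (hE : E.Valid) (h : StageInv E t S z κ) (hT : T = 1 + 2048 * E.m ^ 3)
    (hR : RoundInv E z κ T L R A) (hb : b < T)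
    (hbest : 4 * ∑ v ∈ range E.n, z v * deficit T R b v ≤ (∑ v ∈ range E.n, z v) * T)
    (hz' : ∀ v < E.n, z' v = z v * deficit T R b v / T)
    (hS' : ∀ i < E.m, S' i = if 0 < L b i then 1 else S i) (hκ' : κ' = κ / 2) :
    StageInv E (t + 1) S' z' κ' := by
  have hTpos : 0 < (T : ℝ) := by exact_mod_cast (Nat.zero_le b).trans_lt hb
  have hd := h.stageData hE
  have hκ := hd.budget_pos
  have hK := hE.limit_pos
  have hdef : ∀ v, (deficit T R b v : ℝ) ≤ T := fun v => by
    exact_mod_cast Nat.sub_le _ _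
  have hle : ∀ v < E.n, z' v ≤ z v := fun v hv => by
    rw [hz' v hv, div_le_iff₀ hTpos]
    exact mul_le_mul_of_nonneg_left (hdef v) (h.nonneg v hv)
  refine ⟨?_, ?_, fun v hv => ?_, fun v hv => (hle v hv).trans (h.le_one v hv), ?_,
    fun i hi hl => ?_, fun i hi => ?_, fun i hi hl => ?_⟩
  · rw [hκ', h.budget, pow_succ]
    ring
  · have h1 : E.committeeWeight S' ≤ E.committeeWeight S + E.committeeWeight (L b) := by
      unfold committeeWeight
      rw [← sum_add_distrib]
      refine sum_le_sum fun i hi => ?_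
      have := hE.weight_nonneg i (mem_range.1 hi)
      rw [hS' i (mem_range.1 hi)]
      split_ifs <;> first | omega | linarith
    have := hR.weight_le b hb
    have := h.weight_le
    linarith
  · rw [hz' v hv]
    have := h.nonneg v hv
    positivity
  · rw [sum_congr rfl fun v hv => hz' v (mem_range.1 hv), ← sum_div, div_le_iff₀ hTpos, pow_succ]
    have := mul_le_mul_of_nonneg_right h.sum_le hTpos.le
    linarith
  · rw [hS' i hi]
    split_ifs
    · exact one_pos
    · exact h.small i hi hl
  · rw [hS' i hi]
    split_ifs
    · exact le_rfl
    · exact h.mem_le_one i hi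
  · have hsub : E.dissenters S' i ⊆ E.dissenters S i := by
      intro v hv
      simp only [dissenters, mem_filter] at hv ⊢
      refine ⟨hv.1, fun j hj hSj => hv.2 j hj ?_⟩
      rw [hS' j hj]
      split_ifs <;> omega
    have hlt : ∀ v ∈ E.dissenters S' i, v < E.n := fun v hv =>
      mem_range.1 (mem_filter.1 hv).1
    -- The default rank m of a committee without members exceeds every actual rank; any other rank
    -- is that of a member, which now belongs to S'.
    have hbeat : ∀ v ∈ E.dissenters S' i, E.r v i < R b v := by
      intro v hv
      rcases hR.attained b hb v (hlt v hv) with he | ⟨j, hj, hLj, he⟩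
      · rw [he]
        exact hE.rank_lt v (hlt v hv) i hi
      · rw [← he]
        exact (mem_filter.1 hv).2 j hj (by simp [hS' j hj, hLj])
    have h1 : ∑ v ∈ E.dissenters S' i, (1 - z v) ≤ ∑ v ∈ E.dissenters S i, (1 - z v) :=
      sum_le_sum_of_subset_of_nonneg hsub fun v hv _ => by
        linarith [h.le_one v (mem_range.1 (mem_filter.1 hv).1)]
    -- If i beats committee b for v, it beats every committee that v likes no better than b. So the
    -- fraction of weight lost is at most twice the frequency with which i beats the lottery.
    have h2 : ∀ v ∈ E.dissenters S' i,
        (T : ℝ) * (z v - z' v) ≤ 2 * ∑ s ∈ range T, z v * lt01 (E.r v i) (R s v) := by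
      intro v hv
      have hz := h.nonneg v (hlt v hv)
      have h3 : (T : ℝ) ≤ deficit T R b v + 2 * upperCount T (fun s => R s v) b := by
        unfold deficit
        exact_mod_cast (by omega : T ≤ T - (upperCount T (fun s => R s v) b +
          upperCount T (fun s => R s v) b) + 2 * upperCount T (fun s => R s v) b)
      have h4 : (upperCount T (fun s => R s v) b : ℝ) ≤
          ∑ s ∈ range T, lt01 (E.r v i) (R s v) := by
        unfold upperCount lt01
        rw [Finset.sum_boole]
        have := hbeat v hv
        exact_mod_cast card_le_card (monotone_filter_right _ fun s _ hs => by
          dsimp only at hs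
          omega)
      rw [← mul_sum, hz' v (hlt v hv), mul_sub, mul_div_cancel₀ _ hTpos.ne']
      nlinarith
    have h3 : (T : ℝ) * ∑ v ∈ E.dissenters S' i, (z v - z' v) ≤
        2 * ∑ s ∈ range T, E.score z (R s) i := by
      rw [mul_sum]
      refine (sum_le_sum h2).trans ?_
      rw [← mul_sum, sum_comm]
      refine mul_le_mul_of_nonneg_left (sum_le_sum fun s _ => ?_) zero_le_two
      exact sum_le_sum_of_subset_of_nonneg (filter_subset _ _) fun v hv _ =>
        mul_nonneg (h.nonneg v (mem_range.1 hv)) (lt01_nonneg _ _)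
    have h4 := hR.sum_score_le hd hT hi hl
    have h5 : ∑ v ∈ E.dissenters S' i, (z v - z' v) ≤
        51 / 8 * (E.w i * (∑ v ∈ range E.n, z v) / κ) := by
      refine le_of_mul_le_mul_left ?_ hTpos
      linarith
    -- Z/κ is at most (32/15)(n/K)/2^t, and 51/8 · 32/15 = 68/5 is half of 136/5, matching the
    -- difference of consecutive powers of 1/2.
    have h6 : 51 / 8 * (E.w i * (∑ v ∈ range E.n, z v) / κ) ≤
        136 / 5 * (E.w i * E.n / E.K) * ((1 / 2) ^ t - (1 / 2) ^ (t + 1)) := by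
      have h7 : 51 / 8 * (E.w i * (∑ v ∈ range E.n, z v) / κ) ≤
          51 / 8 * (E.w i * (E.n * (1 / 4) ^ t) / κ) := by
        have := hE.weight_nonneg i hi
        have := h.sum_le
        gcongr
      refine h7.trans (le_of_eq ?_)
      have h8 : (1 / 4 : ℝ) ^ t = (1 / 2) ^ t * (1 / 2) ^ t := by
        rw [← mul_pow]
        norm_num
      have h9 : (1 / 2 : ℝ) ^ t ≠ 0 := by positivity
      rw [h.budget, h8, pow_succ]
      generalize (1 / 2 : ℝ) ^ t = y at h9
      field_simp
      ring
    have h7 : ∑ v ∈ E.dissenters S' i, (1 - z' v) =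
        ∑ v ∈ E.dissenters S' i, (1 - z v) + ∑ v ∈ E.dissenters S' i, (z v - z' v) := by
      rw [← sum_add_distrib]
      exact sum_congr rfl fun v _ => by ring
    have h8 := h.sum_dissenters_le i hi hl
    rw [h7]
    linarith

/-- The dissenters retain weight at most 1/16 and number at least one, so 15/16 of their number is
at most (136/5) w_i n/K; and (16/15)(136/5) < 32. -/
theorem StageInv.card_dissenters_lt {t : ℕ} {S : ℕ → ℕ} {z : ℕ → ℝ} {κ : ℝ} (hE : E.Valid)
    (h : StageInv E t S z κ) (ht : E.n + 2 ≤ t) {i : ℕ} (hi : i < E.m)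
    (hpos : 0 < #(E.dissenters S i)) :
    (#(E.dissenters S i) : ℝ) < 32 * (E.w i / E.K) * E.n := by
  have hn : 0 < E.n := by
    obtain ⟨v, hv⟩ := card_pos.1 hpos
    exact (Nat.zero_le v).trans_lt (mem_range.1 (mem_filter.1 hv).1)
  -- A small candidate is already a member, and no voter strictly prefers it to itself.
  have hl : E.Large i := by
    by_contra hl
    obtain ⟨v, hv⟩ := card_pos.1 hpos
    exact lt_irrefl _ ((mem_filter.1 hv).2 i hi (h.small i hi hl))
  have hm : 0 < (E.m : ℝ) := by exact_mod_cast (Nat.zero_le i).trans_lt hi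
  have hw : 0 < E.w i := by
    have h1 : 0 < 16 * (E.m : ℝ) * E.w i := hE.limit_pos.trans hl
    exact (mul_pos_iff_of_pos_left (by positivity)).1 h1
  have hK := hE.limit_pos
  have h1 : (E.n : ℝ) * (1 / 4) ^ t ≤ 1 / 16 := by
    have h2 : (1 / 4 : ℝ) ^ t ≤ (1 / 4) ^ (E.n + 2) :=
      pow_le_pow_of_le_one (by norm_num) (by norm_num) ht
    have h3 : (E.n : ℝ) ≤ 4 ^ E.n := by exact_mod_cast (Nat.lt_pow_self (by norm_num)).le
    have h4 : (4 : ℝ) ^ E.n * (1 / 4) ^ E.n = 1 := by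
      rw [← mul_pow]
      norm_num
    calc (E.n : ℝ) * (1 / 4) ^ t ≤ 4 ^ E.n * (1 / 4) ^ (E.n + 2) := by gcongr
      _ = 4 ^ E.n * (1 / 4) ^ E.n * (1 / 16) := by
        rw [pow_add]
        ring
      _ = 1 / 16 := by rw [h4, one_mul]
  have h2 : ∑ v ∈ E.dissenters S i, z v ≤ ∑ v ∈ range E.n, z v :=
    sum_le_sum_of_subset_of_nonneg (filter_subset _ _) fun v hv _ => h.nonneg v (mem_range.1 hv)
  have h3 := h.sum_dissenters_le i hi hl
  rw [sum_sub_distrib, sum_const, nsmul_eq_mul, mul_one] at h3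
  have h4 := h.sum_le
  have h5 : (1 : ℝ) ≤ #(E.dissenters S i) := by exact_mod_cast hpos
  have hX : 0 < E.w i * E.n / E.K := by positivity
  have h6 : 136 / 5 * (E.w i * E.n / E.K) * (1 - (1 / 2) ^ t) ≤ 136 / 5 * (E.w i * E.n / E.K) :=
    mul_le_of_le_one_right (by positivity) (by simp)
  have h7 : 32 * (E.w i / E.K) * E.n = 32 * (E.w i * E.n / E.K) := by ring
  rw [h7]
  linarith

end Election

/-! ### Loops for sums, counts and tables -/

/-- The indicator of `x < y`. -/
def ltE (x y : NatExpr) : RealExpr := .ofNat (.sub (.const 1) (.sub (.const 1) (.sub y x)))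

theorem ltE_eval (x y : NatExpr) (s : State) : (ltE x y).eval s = lt01 (x.eval s) (y.eval s) := by
  simp only [ltE, RealExpr.eval, NatExpr.eval, lt01]
  split_ifs with h
  · rw [Nat.sub_eq_zero_of_le (by omega : 1 ≤ y.eval s - x.eval s)]
    simp
  · rw [Nat.sub_eq_zero_of_le (not_lt.1 h)]
    simp

/-- Add the values of `e` for `c < b` to `a[0][0]`. -/
def addLoop (c : ℕ) (b : NatExpr) (a : ℕ) (e : RealExpr) : Program :=
  forLoop c b (setRvar a (.add (rvar a) e))

/-- Add the values of `e` for `c < b` and `c' < b'` to `a[0][0]`. -/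
def addLoop₂ (c : ℕ) (b : NatExpr) (c' : ℕ) (b' : NatExpr) (a : ℕ) (e : RealExpr) : Program :=
  forLoop c b (addLoop c' b' a e)

/-- Store the sum of the values of `e` for `c < b` in `a[0][0]`. -/
def sumTo (c : ℕ) (b : NatExpr) (a : ℕ) (e : RealExpr) : Program :=
  .seq (setRvar a (.ofNat (.const 0))) (addLoop c b a e)

/-- Store the sum of the values of `e` for `c < b` and `c' < b'` in `a[0][0]`. -/
def sumTo₂ (c : ℕ) (b : NatExpr) (c' : ℕ) (b' : NatExpr) (a : ℕ) (e : RealExpr) : Program :=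
  .seq (setRvar a (.ofNat (.const 0))) (addLoop₂ c b c' b' a e)

/-- Add the sum of the values of `e` for `c < b` to the natural number `a[0][0]`. -/
def addNatLoop (c : ℕ) (b : NatExpr) (a : ℕ) (e : NatExpr) : Program :=
  forLoop c b (setNvar a (.add (nvar a) e))

/-- Store the number of `c < b` that pass the test `g` in `a[0][0]`. -/
def countTo (c : ℕ) (b : NatExpr) (a : ℕ) (g : Test) : Program :=
  .seq (setNvar a (.const 0)) (forLoop c b (.ite g (setNvar a (.add (nvar a) (.const 1))) .skip))

/-- Store the values of `e` for `c < b` in the row `ρ` of the table `a` of natural numbers. -/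
def fillNat (c : ℕ) (b : NatExpr) (a : ℕ) (ρ e : NatExpr) : Program :=
  forLoop c b (.setNat a ρ (nvar c) e)

/-- Store the values of `e` for `c < b` in the row `0` of the table `a` of real numbers. -/
def fillReal (c : ℕ) (b : NatExpr) (a : ℕ) (e : RealExpr) : Program :=
  forLoop c b (.setReal a (.const 0) (nvar c) e)

theorem Agree.setNat {s : State} {a i j x : ℕ} {ei ej ex : NatExpr} :
    Agree (.setNat a ei ej ex) s (s.setNat a i j x) := by
  refine ⟨fun d hd => ?_, fun _ _ => rfl⟩
  have : d ≠ a := by simpa [Program.natWrites] using hd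
  funext
  simp [this]

theorem Agree.setReal {s : State} {a i j : ℕ} {x : ℝ} {ei ej : NatExpr} {ex : RealExpr} :
    Agree (.setReal a ei ej ex) s (s.setReal a i j x) := by
  refine ⟨fun _ _ => rfl, fun d hd => ?_⟩
  have : d ≠ a := by simpa [Program.realWrites] using hd
  funext
  simp [this]

theorem Agree.seq_setReal {p : Program} {s s' : State} {a : ℕ} {i j : NatExpr} {x : RealExpr}
    {i' j' : ℕ} {x' : ℝ} (h : Agree p (s.setReal a i' j' x') s') :
    Agree (.seq (.setReal a i j x) p) s s' := by
  refine Agree.trans (s₂ := s.setReal a i' j' x') ⟨fun _ _ => rfl, fun d hd => ?_⟩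
    (Agree.mono (q := .seq (.setReal a i j x) p) h (by simp [Program.natWrites])
      (by simp [Program.realWrites]))
  have : d ≠ a := by
    rintro rfl
    simp [Program.realWrites] at hd
  funext
  simp [this]

theorem Agree.seq_setNat {p : Program} {s s' : State} {a : ℕ} {i j x : NatExpr}
    {i' j' x' : ℕ} (h : Agree p (s.setNat a i' j' x') s') :
    Agree (.seq (.setNat a i j x) p) s s' := by
  refine Agree.trans (s₂ := s.setNat a i' j' x') ⟨fun d hd => ?_, fun _ _ => rfl⟩
    (Agree.mono (q := .seq (.setNat a i j x) p) h (by simp [Program.natWrites])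
      (by simp [Program.realWrites]))
  have : d ≠ a := by
    rintro rfl
    simp [Program.natWrites] at hd
  funext
  simp [this]

section Loops

variable {M c c' a : ℕ} {b b' : NatExpr} {Q : State → Prop} {s : State}

theorem WP.addLoop {e : RealExpr} (N : ℕ) (F : ℕ → ℝ) (hN : N ≤ M)
    (hb : ∀ s', Agree (addLoop c b a e) s s' → b.eval s' = N)
    (hF : ∀ k < N, ∀ s', Agree (CommitteeSelection.addLoop c b a e) s s' → s'.nat c 0 0 = k →
      e.eval s' = F k)
    (hQ : ∀ s', Agree (CommitteeSelection.addLoop c b a e) s s' →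
      s'.real a 0 0 = s.real a 0 0 + ∑ k ∈ range N, F k → Q s') : WP M (addLoop c b a e) Q s := by
  refine WP.forLoop N (fun k s' => s'.real a 0 0 = s.real a 0 0 + ∑ k ∈ range k, F k) hN hb
    (by simp [Program.natWrites]) (by simp) (fun k hk s' h1 h2 h3 => WP.setReal ?_) hQ
  simp only [RealExpr.eval, NatExpr.eval, State.setNat_real, State.setReal_real, and_self, if_true,
    h3, hF k hk s' h1 h2, sum_range_succ, add_assoc]

theorem WP.sumTo {e : RealExpr} (N : ℕ) (F : ℕ → ℝ) (hN : N ≤ M)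
    (hb : ∀ s', Agree (sumTo c b a e) s s' → b.eval s' = N)
    (hF : ∀ k < N, ∀ s', Agree (CommitteeSelection.sumTo c b a e) s s' → s'.nat c 0 0 = k →
      e.eval s' = F k)
    (hQ : ∀ s', Agree (CommitteeSelection.sumTo c b a e) s s' →
      s'.real a 0 0 = ∑ k ∈ range N, F k → Q s') : WP M (sumTo c b a e) Q s := by
  have key : ∀ s', Agree (CommitteeSelection.addLoop c b a e) (s.setReal a 0 0 0) s' →
      Agree (CommitteeSelection.sumTo c b a e) s s' :=
    fun s' h => h.seq_setReal
  refine WP.seq (WP.setReal ?_)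
  simp only [RealExpr.eval, NatExpr.eval, Nat.cast_zero]
  exact WP.addLoop N F hN (fun s' h => hb s' (key s' h)) (fun k hk s' h => hF k hk s' (key s' h))
    fun s' h h' => hQ s' (key s' h) (by simpa using h')

theorem WP.sumTo₂ {e : RealExpr} (N N' : ℕ) (F : ℕ → ℕ → ℝ) (hN : N ≤ M) (hN' : N' ≤ M)
    (hcc : c ≠ c')
    (hb : ∀ s', Agree (sumTo₂ c b c' b' a e) s s' → b.eval s' = N)
    (hb' : ∀ s', Agree (CommitteeSelection.sumTo₂ c b c' b' a e) s s' → b'.eval s' = N')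
    (hF : ∀ k < N, ∀ l < N', ∀ s', Agree (CommitteeSelection.sumTo₂ c b c' b' a e) s s' →
      s'.nat c 0 0 = k → s'.nat c' 0 0 = l → e.eval s' = F k l)
    (hQ : ∀ s', Agree (CommitteeSelection.sumTo₂ c b c' b' a e) s s' →
      s'.real a 0 0 = ∑ k ∈ range N, ∑ l ∈ range N', F k l → Q s') :
    WP M (sumTo₂ c b c' b' a e) Q s := by
  have key : ∀ s', Agree (CommitteeSelection.addLoop₂ c b c' b' a e) (s.setReal a 0 0 0) s' →
      Agree (CommitteeSelection.sumTo₂ c b c' b' a e) s s' :=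
    fun s' h => h.seq_setReal
  refine WP.seq (WP.setReal ?_)
  simp only [RealExpr.eval, NatExpr.eval, Nat.cast_zero]
  have key' : ∀ s₁ s₂, Agree (CommitteeSelection.addLoop₂ c b c' b' a e) (s.setReal a 0 0 0) s₁ →
      Agree (CommitteeSelection.addLoop c' b' a e) s₁ s₂ →
      Agree (CommitteeSelection.sumTo₂ c b c' b' a e) s s₂ := fun s₁ s₂ h h' =>
    key s₂ (h.trans (h'.mono
      (by simp [CommitteeSelection.addLoop₂, CommitteeSelection.forLoop, Program.natWrites])
      (by simp [CommitteeSelection.addLoop₂, CommitteeSelection.forLoop, Program.realWrites])))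
  have hc : c ∉ (CommitteeSelection.addLoop c' b' a e).natWrites := by
    simp [CommitteeSelection.addLoop, CommitteeSelection.forLoop, Program.natWrites, hcc]
  refine WP.forLoop N (fun k s' => s'.real a 0 0 = ∑ k ∈ range k, ∑ l ∈ range N', F k l) hN
    (fun s' h => hb s' (key s' h)) hc (by simp) (fun k hk s' h1 h2 h3 => ?_)
    fun s' h h' => hQ s' (key s' h) h'
  refine WP.addLoop N' (F k) hN' (fun s'' h => hb' s'' (key' s' s'' h1 h))
    (fun l hl s'' h => hF k hk l hl s'' (key' s' s'' h1 h) (by rw [h.1 c hc, h2]))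
    fun s'' _ h => ?_
  rw [State.setNat_real, h, h3, sum_range_succ]

theorem WP.addNatLoop {e : NatExpr} (N : ℕ) (F : ℕ → ℕ) (hN : N ≤ M) (hca : c ≠ a)
    (hb : ∀ s', Agree (addNatLoop c b a e) s s' → b.eval s' = N)
    (hF : ∀ k < N, ∀ s', Agree (CommitteeSelection.addNatLoop c b a e) s s' → s'.nat c 0 0 = k →
      e.eval s' = F k)
    (hQ : ∀ s', Agree (CommitteeSelection.addNatLoop c b a e) s s' →
      s'.nat a 0 0 = s.nat a 0 0 + ∑ k ∈ range N, F k → Q s') : WP M (addNatLoop c b a e) Q s := by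
  refine WP.forLoop N (fun k s' => s'.nat a 0 0 = s.nat a 0 0 + ∑ k ∈ range k, F k) hN hb
    (by simpa [Program.natWrites] using hca) (by simp [hca.symm])
    (fun k hk s' h1 h2 h3 => WP.setNat ?_) hQ
  simp [NatExpr.eval, hca.symm, h3, hF k hk s' h1 h2, sum_range_succ, add_assoc]

theorem WP.countTo {g : Test} (N : ℕ) (G : ℕ → Prop) [DecidablePred G] (hN : N ≤ M) (hca : c ≠ a)
    (hb : ∀ s', Agree (countTo c b a g) s s' → b.eval s' = N)
    (hF : ∀ k < N, ∀ s', Agree (CommitteeSelection.countTo c b a g) s s' → s'.nat c 0 0 = k →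
      (g.holds s' ↔ G k))
    (hQ : ∀ s', Agree (CommitteeSelection.countTo c b a g) s s' →
      s'.nat a 0 0 = #{k ∈ range N | G k} → Q s') : WP M (countTo c b a g) Q s := by
  have key : ∀ s', Agree (CommitteeSelection.forLoop c b
      (.ite g (setNvar a (.add (nvar a) (.const 1))) .skip)) (s.setNat a 0 0 0) s' →
      Agree (CommitteeSelection.countTo c b a g) s s' :=
    fun s' h => h.seq_setNat
  refine WP.seq (WP.setNat ?_)
  simp only [NatExpr.eval]
  refine WP.forLoop N (fun k s' => s'.nat a 0 0 = #{k ∈ range k | G k}) hN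
    (fun s' h => hb s' (key s' h))
    (by simpa [Program.natWrites] using hca) (by simp) (fun k hk s' h1 h2 h3 => ?_)
    (fun s' h => hQ s' (key s' h))
  have h4 := hF k hk s' (key s' h1) h2
  rw [range_add_one, filter_insert]
  refine WP.ite (fun hg => WP.setNat ?_) fun hg => WP.skip ?_
  · simp [NatExpr.eval, hca.symm, h3, if_pos (h4.1 hg)]
  · simp [hca.symm, h3, if_neg fun h => hg (h4.2 h)]

/-- `hF` may assume that the entry about to be overwritten still has its old value; this permits
updates in place, such as taking minima of ranks. -/
theorem WP.fillNat {ρ e : NatExpr} (N row : ℕ) (F : ℕ → ℕ) (hN : N ≤ M) (hca : c ≠ a)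
    (hb : ∀ s', Agree (fillNat c b a ρ e) s s' → b.eval s' = N)
    (hρ : ∀ s', Agree (CommitteeSelection.fillNat c b a ρ e) s s' → ρ.eval s' = row)
    (hF : ∀ k < N, ∀ s', Agree (CommitteeSelection.fillNat c b a ρ e) s s' → s'.nat c 0 0 = k →
      s'.nat a row k = s.nat a row k → e.eval s' = F k)
    (hQ : ∀ s', Agree (CommitteeSelection.fillNat c b a ρ e) s s' →
      (∀ k < N, s'.nat a row k = F k) → (∀ i, i ≠ row → s'.nat a i = s.nat a i) → Q s') :
    WP M (fillNat c b a ρ e) Q s := by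
  refine WP.forLoop N (fun k s' => (∀ l < k, s'.nat a row l = F l) ∧
    (∀ l, k ≤ l → s'.nat a row l = s.nat a row l) ∧ ∀ i, i ≠ row → s'.nat a i = s.nat a i) hN hb
    (by simpa [Program.natWrites] using hca)
    ⟨by simp, fun l _ => by simp [hca.symm], fun i _ => funext fun j => by simp [hca.symm]⟩
    (fun k hk s' h1 h2 h3 => WP.setNat ?_) fun s' h1 h2 => hQ s' h1 h2.1 h2.2.2
  obtain ⟨h3, h4, h5⟩ := h3
  simp only [NatExpr.eval, hρ s' h1, h2, hF k hk s' h1 h2 (h4 k le_rfl)]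
  refine ⟨fun l hl => ?_, fun l hl => ?_, fun i hi => funext fun j => ?_⟩
  · rcases Nat.lt_succ_iff_lt_or_eq.1 hl with hl | rfl
    · simp [hca.symm, hl.ne, h3 l hl]
    · simp [hca.symm]
  · have : l ≠ k := by omega
    simp [hca.symm, this, h4 l (by omega)]
  · simp [hca.symm, hi, h5 i hi]

theorem WP.fillReal {e : RealExpr} (N : ℕ) (F : ℕ → ℝ) (hN : N ≤ M)
    (hb : ∀ s', Agree (fillReal c b a e) s s' → b.eval s' = N)
    (hF : ∀ k < N, ∀ s', Agree (CommitteeSelection.fillReal c b a e) s s' → s'.nat c 0 0 = k →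
      s'.real a 0 k = s.real a 0 k → e.eval s' = F k)
    (hQ : ∀ s', Agree (CommitteeSelection.fillReal c b a e) s s' →
      (∀ k < N, s'.real a 0 k = F k) → Q s') :
    WP M (fillReal c b a e) Q s := by
  refine WP.forLoop N (fun k s' => (∀ l < k, s'.real a 0 l = F l) ∧
    (∀ l, k ≤ l → s'.real a 0 l = s.real a 0 l)) hN hb
    (by simp [Program.natWrites]) ⟨by simp, fun l _ => by simp⟩
    (fun k hk s' h1 h2 h3 => WP.setReal ?_) fun s' h1 h2 => hQ s' h1 h2.1
  obtain ⟨h3, h4⟩ := h3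
  simp only [NatExpr.eval, h2, hF k hk s' h1 h2 (h4 k le_rfl)]
  refine ⟨fun l hl => ?_, fun l hl => ?_⟩
  · rcases Nat.lt_succ_iff_lt_or_eq.1 hl with hl | rfl
    · simp [hl.ne, h3 l hl]
    · simp
  · have : l ≠ k := by omega
    simp [this, h4 l (by omega)]

end Loops

/-! ### The program

Every voter has a weight, initially `1`. A stage with budget `κ` computes a sequence of committees
of weight at most `κ`, such that no candidate is much better than the committees on average; every
committee is found greedily, against the weights of the candidates that have done well so far. It
selects one of these committees, decreases the weight of each voter according to the rank of this
committee among the others, and halves the budget. After `n + 2` stages the total weight of the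
voters is less than `1`, and the union of the selected committees is the output.

Arrays of natural numbers: `3[v][i]` is the rank of candidate `i` for voter `v`; `5[s][i]` and
`4[s][v]` are the members and the ranks of the committee of round `s`; `7[s][v]` is the deficit of
voter `v` for it; `8` is the number of rounds; `6` is the candidate or the round that has been found
by a search; `9`, `17` and `18` are accumulators; `10` to `16` are counters.

Arrays of real numbers: `4[0][v]` is the weight of voter `v`; `5` is the budget; `6[0][i]` is the
weight of candidate `i` in the current round; `8` is the weight of the current committee; `9` is an
accumulator; `10`, `11` and `12` are the total weight of the voters, the uncovered weight and the
average weight of the candidates. -/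

/-- The real constant `k`. -/
abbrev constR (k : ℕ) : RealExpr := .ofNat (.const k)

abbrev weightE (i : NatExpr) : RealExpr := .get 2 i (.const 0)

abbrev voterE : RealExpr := .get 4 (.const 0) (nvar 14)

abbrev candE (i : NatExpr) : RealExpr := .get 6 (.const 0) i

abbrev largeTest (i : NatExpr) : Test :=
  .realLt (rvar 1) (.mul (.mul (constR 16) (.ofNat (nvar 0))) (weightE i))

/-- Run `p` if candidate `i` is relevant in the current stage. -/
def ifRelevant (i : NatExpr) (p : Program) : Program :=
  .ite (largeTest i) (.ite (.realLt (rvar 5) (.mul (constR 3) (weightE i))) .skip p) .skip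

def uncoveredE : RealExpr :=
  .mul (.mul voterE (candE (nvar 15)))
    (ltE (.get 3 (nvar 14) (nvar 15)) (.get 4 (nvar 11) (nvar 14)))

def gainE : RealExpr :=
  .mul (.mul (.mul voterE (candE (nvar 15)))
    (ltE (.get 3 (nvar 14) (nvar 13)) (.add (.get 3 (nvar 14) (nvar 15)) (.const 1))))
    (ltE (.get 3 (nvar 14) (nvar 15)) (.get 4 (nvar 11) (nvar 14)))

/-- A later success overwrites an earlier one; the initial value m of the register means that
nothing has been found. -/
def candidateTest : Program :=
  .seq (sumTo₂ 14 (nvar 1) 15 (nvar 0) 9 gainE)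
    (ifRelevant (nvar 13)
      (.ite (.realLt (.mul (.mul (.mul (constR 2) (rvar 10)) (rvar 12)) (rvar 9))
          (.mul (weightE (nvar 13)) (.mul (rvar 11) (rvar 11))))
        .skip (setNvar 6 (nvar 13))))

/-- Search a relevant candidate that covers enough for its weight. -/
def candidateSearch : Program :=
  .seq (sumTo₂ 14 (nvar 1) 15 (nvar 0) 11 uncoveredE)
    (.seq (setNvar 6 (nvar 0)) (forLoop 13 (nvar 0) candidateTest))

def addMember : Program :=
  .seq (.setNat 5 (nvar 11) (nvar 6) (.const 1))
    (.seq (setRvar 8 (.add (rvar 8) (weightE (nvar 6))))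
      (fillNat 14 (nvar 1) 4 (nvar 11) (.sub (.get 4 (nvar 11) (nvar 14))
        (.sub (.get 4 (nvar 11) (nvar 14)) (.get 3 (nvar 14) (nvar 6))))))

def greedyStep : Program :=
  .seq candidateSearch
    (.ite (.natLt (nvar 6) (nvar 0))
      (.ite (.realLt (.mul (constR 2) (rvar 5)) (.mul (constR 3) (rvar 8))) .skip addMember) .skip)

def updateCandidate : Program :=
  ifRelevant (nvar 15)
    (.seq (sumTo 14 (nvar 1) 9
      (.mul voterE (ltE (.get 3 (nvar 14) (nvar 15)) (.get 4 (nvar 11) (nvar 14)))))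
    (.seq (.setReal 6 (.const 0) (nvar 15) (.add (candE (nvar 15)) (.sub (rvar 9)
      (.mul (.div (.mul (constR 3) (rvar 10)) (rvar 5)) (weightE (nvar 15))))))
    (.ite (.realLt (candE (nvar 15)) (constR 0))
      (.setReal 6 (.const 0) (nvar 15) (constR 0)) .skip)))

/-- Natural numbers cannot be multiplied by the machine; four doublings give the bound 16m on the
greedy steps. -/
def double (x : NatExpr) : NatExpr := .add x x

def round : Program :=
  .seq (fillNat 14 (nvar 1) 4 (nvar 11) (nvar 0))
  (.seq (fillNat 15 (nvar 0) 5 (nvar 11) (.const 0))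
  (.seq (setRvar 8 (constR 0))
  (.seq (sumTo 15 (nvar 0) 12 (.mul (candE (nvar 15)) (weightE (nvar 15))))
  (.seq (forLoop 12 (double (double (double (double (nvar 0))))) greedyStep)
    (forLoop 15 (nvar 0) updateCandidate)))))

/-- Compute a distribution over committees. -/
def lottery : Program :=
  .seq (sumTo 14 (nvar 1) 10 voterE)
  (.seq (fillReal 15 (nvar 0) 6 (constR 0))
    (forLoop 11 (nvar 8) round))

def computeDeficits : Program :=
  forLoop 14 (nvar 1)
    (.seq (countTo 16 (nvar 8) 9 (.natLt (.get 4 (nvar 11) (nvar 14))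
        (.add (.get 4 (nvar 16) (nvar 14)) (.const 1))))
      (.setNat 7 (nvar 11) (nvar 14) (.sub (nvar 8) (.add (nvar 9) (nvar 9)))))

/-- Search a committee of the lottery for which the deficits are small on average. -/
def select : Program :=
  .seq (setNvar 6 (.const 0))
    (forLoop 11 (nvar 8)
      (.seq computeDeficits
      (.seq (sumTo 14 (nvar 1) 9 (.mul voterE (.ofNat (.get 7 (nvar 11) (nvar 14)))))
        (.ite (.realLt (.mul (rvar 10) (.ofNat (nvar 8))) (.mul (constR 4) (rvar 9)))
          .skip (setNvar 6 (nvar 11))))))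

def advance : Program :=
  .seq (fillReal 14 (nvar 1) 4 (.div (.mul voterE (.ofNat (.get 7 (nvar 6) (nvar 14))))
      (.ofNat (nvar 8))))
  (.seq (forLoop 15 (nvar 0) (.ite (.natLt (.const 0) (.get 5 (nvar 6) (nvar 15)))
      (.setNat 2 (nvar 15) (.const 0) (.const 1)) .skip))
    (setRvar 5 (.div (rvar 5) (constR 2))))

def stage : Program := .seq lottery (.seq select advance)

def computeRanks : Program :=
  forLoop 14 (nvar 1) (forLoop 15 (nvar 0)
    (.seq (countTo 13 (nvar 0) 9
        (.realLt (.get 3 (nvar 14) (nvar 13)) (.get 3 (nvar 14) (nvar 15))))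
      (.setNat 3 (nvar 14) (nvar 15) (nvar 9))))

/-- Set the number of rounds to `1 + 2048 * m ^ 3`. -/
def computeRounds : Program :=
  .seq (addNatLoop 15 (nvar 0) 17 (nvar 0))
  (.seq (addNatLoop 15 (nvar 0) 18 (nvar 17))
  (.seq (setNvar 8 (.const 1))
    (addNatLoop 15 (.const 2048) 8 (nvar 18))))

def prepare : Program :=
  .seq (forLoop 15 (nvar 0) (.ite (largeTest (nvar 15)) .skip
    (.setNat 2 (nvar 15) (.const 0) (.const 1))))
  (.seq (fillReal 14 (nvar 1) 4 (constR 1))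
    (setRvar 5 (.div (.mul (constR 15) (rvar 1)) (constR 32))))

/-- The whole algorithm. -/
def committeeProgram : Program :=
  .seq computeRanks
  (.seq computeRounds
  (.seq prepare
    (forLoop 10 (.add (nvar 1) (.const 2)) stage)))

/-! ### Correctness of the program -/

/-- The memory holds the election `E` and the number of rounds `T`. -/
structure Holds (E : Election) (T : ℕ) (s : State) : Prop where
  cands : s.nat 0 0 0 = E.m
  voters : s.nat 1 0 0 = E.n
  rank : s.nat 3 = E.r
  rounds : s.nat 8 0 0 = T
  limit : s.real 1 0 0 = E.K
  weight : ∀ i, s.real 2 i 0 = E.w i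

theorem Holds.agree {E : Election} {T : ℕ} {p : Program} {s s' : State} (h : Holds E T s)
    (ha : Agree p s s') (hp : (∀ a ∈ [0, 1, 3, 8], a ∉ p.natWrites) ∧
      ∀ a ∈ [1, 2], a ∉ p.realWrites) : Holds E T s' where
  cands := by rw [ha.1 0 (hp.1 0 (by simp)), h.cands]
  voters := by rw [ha.1 1 (hp.1 1 (by simp)), h.voters]
  rank := by rw [ha.1 3 (hp.1 3 (by simp)), h.rank]
  rounds := by rw [ha.1 8 (hp.1 8 (by simp)), h.rounds]
  limit := by rw [ha.2 1 (hp.2 1 (by simp)), h.limit]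
  weight i := by rw [ha.2 2 (hp.2 2 (by simp)), h.weight]

/-- The memory holds, in addition, the weights `z` of the voters and the budget `κ`. -/
structure HoldsStage (E : Election) (T : ℕ) (z : ℕ → ℝ) (κ : ℝ) (s : State) : Prop
    extends Holds E T s where
  voter : s.real 4 0 = z
  budget : s.real 5 0 0 = κ
  total : s.real 10 0 0 = ∑ v ∈ range E.n, z v

theorem HoldsStage.agree {E : Election} {T : ℕ} {z : ℕ → ℝ} {κ : ℝ} {p : Program} {s s' : State}
    (h : HoldsStage E T z κ s) (ha : Agree p s s') (hp : (∀ a ∈ [0, 1, 3, 8], a ∉ p.natWrites) ∧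
      ∀ a ∈ [1, 2, 4, 5, 10], a ∉ p.realWrites) : HoldsStage E T z κ s' where
  toHolds := h.toHolds.agree ha ⟨hp.1, fun a h => hp.2 a (by
    simp only [List.mem_cons, List.not_mem_nil] at h ⊢
    tauto)⟩
  voter := by rw [ha.2 4 (hp.2 4 (by simp)), h.voter]
  budget := by rw [ha.2 5 (hp.2 5 (by simp)), h.budget]
  total := by rw [ha.2 10 (hp.2 10 (by simp)), h.total]

section

variable {E : Election} {T M : ℕ} {z q : ℕ → ℝ} {κ : ℝ} {s : State} {Q : State → Prop}

theorem holds_largeTest (h : Holds E T s) {e : NatExpr} :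
    (largeTest e).holds s ↔ E.Large (e.eval s) := by
  simp [Test.holds, RealExpr.eval, NatExpr.eval, h.limit, h.cands, h.weight, Election.Large]

theorem WP.ifRelevant (h : HoldsStage E T z κ s) {e : NatExpr} {p : Program}
    (hp : E.Relevant κ (e.eval s) → WP M p Q s) (hs : ¬ E.Relevant κ (e.eval s) → Q s) :
    WP M (ifRelevant e p) Q s := by
  refine WP.ite (fun h1 => WP.ite (fun h2 => WP.skip (hs ?_)) fun h2 => hp ?_)
    fun h1 => WP.skip (hs ?_)
  · intro hr
    exact hr.2 (by simpa [Test.holds, RealExpr.eval, NatExpr.eval, h.budget, h.weight] using h2)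
  · refine ⟨(holds_largeTest h.toHolds).1 h1, ?_⟩
    simpa [Test.holds, RealExpr.eval, NatExpr.eval, h.budget, h.weight] using h2
  · exact fun hr => h1 ((holds_largeTest h.toHolds).2 hr.1)

theorem candidateSearch_spec {k : ℕ} (hs : HoldsStage E T z κ s) (hk : s.nat 11 0 0 = k)
    (hq : s.real 6 0 = q) (hQw : s.real 12 0 0 = ∑ i ∈ range E.m, q i * E.w i)
    (hn : E.n ≤ M) (hm : E.m ≤ M) :
    WP M candidateSearch (fun s' =>
      (s'.nat 6 0 0 = E.m ∧ ∀ j < E.m, E.Relevant κ j → ¬ E.Good z q (s.nat 4 k) j) ∨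
      (s'.nat 6 0 0 < E.m ∧ E.Relevant κ (s'.nat 6 0 0) ∧
        E.Good z q (s.nat 4 k) (s'.nat 6 0 0))) s := by
  refine WP.seq (WP.sumTo₂ E.n E.m
    (fun v i => z v * q i * lt01 (E.r v i) (s.nat 4 k v)) hn hm (by norm_num)
    (fun s₁ h₁ => (hs.agree h₁ (by decide)).voters) (fun s₁ h₁ => (hs.agree h₁ (by decide)).cands)
    (fun v _ i _ s₁ h₁ hv hi => ?_) fun s₁ h₁ hU => WP.seq (WP.setNat ?_))
  · have := hs.agree h₁ (by decide)
    simp only [uncoveredE, RealExpr.eval, NatExpr.eval, ltE_eval, hv, hi, this.voter, this.rank,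
      h₁.1 4 (by decide), h₁.1 11 (by decide), h₁.2 6 (by decide), hk, hq]
  have hs₁ := hs.agree h₁ (by decide)
  simp only [NatExpr.eval, hs₁.cands]
  set s₂ := s₁.setNat 6 0 0 E.m with hs₂def
  have hs₂ : HoldsStage E T z κ s₂ :=
    hs₁.agree (Agree.setNat (ei := .const 0) (ej := .const 0) (ex := .const 0)) (by decide)
  have hr₂ : s₂.real = s₁.real := rfl
  have h4₂ : s₂.nat 4 = s.nat 4 := by
    rw [← h₁.1 4 (by decide)]
    funext
    simp [hs₂def]
  have h11₂ : s₂.nat 11 0 0 = k := by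
    rw [← hk, ← h₁.1 11 (by decide)]
    simp [hs₂def]
  refine WP.forLoop E.m (fun l s' =>
    (s'.nat 6 0 0 = E.m ∧ ∀ j < l, E.Relevant κ j → ¬ E.Good z q (s.nat 4 k) j) ∨
      (s'.nat 6 0 0 < E.m ∧ E.Relevant κ (s'.nat 6 0 0) ∧
        E.Good z q (s.nat 4 k) (s'.nat 6 0 0))) hm
    (fun s₃ h₃ => (hs₂.agree h₃ (by decide)).cands) (by decide) (.inl (by simp [hs₂def]))
    (fun j hj s₃ h₃ hj₃ hI => ?_) (fun _ _ h => h)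
  have hs₃ := hs₂.agree h₃ (by decide)
  refine WP.seq (WP.sumTo₂ E.n E.m
    (fun v i => z v * q i * lt01 (E.r v j) (E.r v i + 1) * lt01 (E.r v i) (s.nat 4 k v)) hn hm
    (by norm_num) (fun s₄ h₄ => (hs₃.agree h₄ (by decide)).voters)
    (fun s₄ h₄ => (hs₃.agree h₄ (by decide)).cands)
    (fun v _ i _ s₄ h₄ hv hi => ?_) fun s₄ h₄ hg => ?_)
  · have := hs₃.agree h₄ (by decide)
    simp only [gainE, RealExpr.eval, NatExpr.eval, ltE_eval, hv, hi, this.voter, this.rank,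
      h₄.1 4 (by decide), h₃.1 4 (by decide), h4₂, h₄.1 11 (by decide), h₃.1 11 (by decide), h11₂,
      h₄.1 13 (by decide), hj₃, h₄.2 6 (by decide), h₃.2 6 (by decide), hr₂, h₁.2 6 (by decide), hq]
  have hs₄ := hs₃.agree h₄ (by decide)
  have hj₄ : s₄.nat 13 0 0 = j := by rw [h₄.1 13 (by decide), hj₃]
  have h6₄ : s₄.nat 6 0 0 = s₃.nat 6 0 0 := by rw [h₄.1 6 (by decide)]
  refine WP.ifRelevant hs₄ (fun hrel => ?_) fun hrel => ?_
  · simp only [NatExpr.eval, hj₄] at hrel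
    have htest : Test.holds s₄ (.realLt (.mul (.mul (.mul (constR 2) (rvar 10)) (rvar 12)) (rvar 9))
          (.mul (weightE (nvar 13)) (.mul (rvar 11) (rvar 11)))) ↔
        ¬ E.Good z q (s.nat 4 k) j := by
      simp only [Test.holds, RealExpr.eval, NatExpr.eval, Election.Good, not_le, hs₄.total,
        h₄.2 12 (by decide), h₃.2 12 (by decide), hr₂, h₁.2 12 (by decide), hQw, hg, hj₄,
        hs₄.weight, h₄.2 11 (by decide), h₃.2 11 (by decide), hU, uncovered, gain, sq, Nat.cast_ofNat]
    refine WP.ite (fun hb => WP.skip ?_) fun hb => WP.setNat ?_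
    · have hb := htest.1 hb
      simp only [State.setNat_nat, h6₄]
      refine hI.imp (fun h => ⟨h.1, fun l hl hr => ?_⟩) id
      rcases Nat.lt_succ_iff_lt_or_eq.1 hl with hl | rfl
      · exact h.2 l hl hr
      · exact hb
    · have hb := not_not.1 (mt htest.2 hb)
      refine .inr ?_
      simp only [NatExpr.eval, hj₄]
      exact ⟨by simpa using hj, by simpa using hrel, by simpa using hb⟩
  · simp only [NatExpr.eval, hj₄] at hrel
    simp only [State.setNat_nat, h6₄]
    refine hI.imp (fun h => ⟨h.1, fun l hl hr => ?_⟩) id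
    rcases Nat.lt_succ_iff_lt_or_eq.1 hl with hl | rfl
    · exact h.2 l hl hr
    · exact absurd hr hrel

theorem addMember_spec {k l : ℕ} (hd : E.StageData z κ) (hq : ∀ i < E.m, 0 ≤ q i)
    (hs : HoldsStage E T z κ s) (hk : s.nat 11 0 0 = k) (hn : E.n ≤ M)
    (hG : E.GreedyInv z q κ l (s.nat 5 k) (s.nat 4 k) (s.real 8 0 0)) (hj : s.nat 6 0 0 < E.m)
    (hrel : E.Relevant κ (s.nat 6 0 0)) (hg : E.Good z q (s.nat 4 k) (s.nat 6 0 0))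
    (hW : ¬ 2 * κ < 3 * s.real 8 0 0) :
    WP M addMember (fun s' =>
      E.GreedyInv z q κ (l + 1) (s'.nat 5 k) (s'.nat 4 k) (s'.real 8 0 0) ∧
      ∀ i, i ≠ k → s'.nat 5 i = s.nat 5 i ∧ s'.nat 4 i = s.nat 4 i) s := by
  refine WP.seq (WP.setNat (WP.seq (WP.setReal ?_)))
  simp only [NatExpr.eval, RealExpr.eval, hk, State.setNat_real, State.setNat_nat, hs.weight,
    Nat.reduceEqDiff, false_and, if_false]
  set j := s.nat 6 0 0 with hjdef
  set s₁ := (s.setNat 5 k j 1).setReal 8 0 0 (s.real 8 0 0 + E.w j) with hs₁def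
  have hA : Agree (.seq (.setNat 5 (nvar 11) (nvar 6) (.const 1))
      (setRvar 8 (.const 0 |> .ofNat))) s s₁ := Agree.seq_setNat Agree.setReal
  have hs₁ := hs.agree hA (by decide)
  have h5 : ∀ i i', s₁.nat 5 i i' = if i = k ∧ i' = j then 1 else s.nat 5 i i' := fun i i' => by
    simp [hs₁def]
  have h8 : s₁.real 8 0 0 = s.real 8 0 0 + E.w j := by simp [hs₁def]
  refine WP.fillNat E.n k (fun v => s.nat 4 k v - (s.nat 4 k v - E.r v j)) hn (by decide)
    (fun s₂ h₂ => (hs₁.agree h₂ (by decide)).voters) (fun s₂ h₂ => ?_)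
    (fun v hv s₂ h₂ hv₂ h4 => ?_) (fun s₂ h₂ h4 h4' => ⟨?_, fun i hi => ⟨?_, ?_⟩⟩)
  · simp only [NatExpr.eval, h₂.1 11 (by decide), hA.1 11 (by decide), hk]
  · have := hs₁.agree h₂ (by decide)
    simp only [NatExpr.eval, h₂.1 11 (by decide), hA.1 11 (by decide), hk, hv₂, h4,
      hA.1 4 (by decide), this.rank, h₂.1 6 (by decide), hA.1 6 (by decide), ← hjdef]
  · rw [h₂.2 8 (by decide), h8]
    refine hG.add hd hq hj hrel hg hW (fun i => ?_) h4
    rw [h₂.1 5 (by decide), h5]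
    simp
  · rw [h₂.1 5 (by decide)]
    funext i'
    rw [h5, if_neg fun h => hi h.1]
  · rw [h4' i hi, hA.1 4 (by decide)]

theorem greedyStep_spec {k l : ℕ} (hd : E.StageData z κ) (hq : ∀ i < E.m, 0 ≤ q i)
    (hqrel : ∀ i < E.m, ¬ E.Relevant κ i → q i = 0)
    (hs : HoldsStage E T z κ s) (hk : s.nat 11 0 0 = k)
    (hq' : s.real 6 0 = q) (hQw : s.real 12 0 0 = ∑ i ∈ range E.m, q i * E.w i)
    (hn : E.n ≤ M) (hm : E.m ≤ M)
    (hG : E.GreedyInv z q κ l (s.nat 5 k) (s.nat 4 k) (s.real 8 0 0)) :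
    WP M greedyStep (fun s' =>
      E.GreedyInv z q κ (l + 1) (s'.nat 5 k) (s'.nat 4 k) (s'.real 8 0 0) ∧
      ∀ i, i ≠ k → s'.nat 5 i = s.nat 5 i ∧ s'.nat 4 i = s.nat 4 i) s := by
  refine WP.seq ((candidateSearch_spec hs hk hq' hQw hn hm).mono fun s₁ h₁ hsearch => ?_)
  have hs₁ := hs.agree h₁ (by decide)
  have h5 := h₁.1 5 (by decide)
  have h4 := h₁.1 4 (by decide)
  have h8 := h₁.2 8 (by decide)
  have hk₁ : s₁.nat 11 0 0 = k := by rw [h₁.1 11 (by decide), hk]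
  rw [← h5, ← h4, ← h8] at hG
  rw [← h4] at hsearch
  simp only [← h5, ← h4]
  refine WP.ite (fun hj => WP.ite (fun hW => WP.skip ⟨?_, fun _ _ => ⟨rfl, rfl⟩⟩) fun hW => ?_)
    fun hj => WP.skip ⟨?_, fun _ _ => ⟨rfl, rfl⟩⟩
  · simp only [Test.holds, RealExpr.eval, NatExpr.eval, hs₁.budget, Nat.cast_ofNat] at hW
    exact hG.skip hd hq hqrel (.inl hW)
  · simp only [Test.holds, RealExpr.eval, NatExpr.eval, hs₁.budget, hs₁.cands,
      Nat.cast_ofNat] at hW hj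
    rcases hsearch with h | h
    · exact absurd h.1 hj.ne
    · exact addMember_spec hd hq hs₁ hk₁ hn hG hj h.2.1 h.2.2 hW
  · simp only [Test.holds, NatExpr.eval, hs₁.cands] at hj
    rcases hsearch with h | h
    · exact hG.skip hd hq hqrel (.inr h.2)
    · exact absurd h.1 hj

open Classical in
theorem updateCandidates_spec {k : ℕ} {A : ℕ → ℝ} (hs : HoldsStage E T z κ s)
    (hk : s.nat 11 0 0 = k) (hA : s.real 6 0 = A) (hn : E.n ≤ M) (hm : E.m ≤ M) :
    WP M (forLoop 15 (nvar 0) updateCandidate) (fun s' => ∀ i < E.m, s'.real 6 0 i =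
      if E.Relevant κ i then max (A i + (E.score z (s.nat 4 k) i -
        3 * (∑ v ∈ range E.n, z v) / κ * E.w i)) 0 else A i) s := by
  refine WP.forLoop E.m (fun l s' => (∀ i < l, s'.real 6 0 i =
      if E.Relevant κ i then max (A i + (E.score z (s.nat 4 k) i -
        3 * (∑ v ∈ range E.n, z v) / κ * E.w i)) 0 else A i) ∧
      ∀ i, l ≤ i → s'.real 6 0 i = A i) hm (fun s₁ h₁ => (hs.agree h₁ (by decide)).cands)
    (by decide) ⟨by simp, fun i _ => by simp [hA]⟩ (fun l hl s₁ h₁ hl₁ hI => ?_)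
    fun s₁ _ h => h.1
  obtain ⟨hI, hI'⟩ := hI
  have hs₁ := hs.agree h₁ (by decide)
  refine WP.ifRelevant hs₁ (fun hrel => ?_) fun hrel => ?_
  · simp only [NatExpr.eval, hl₁] at hrel
    refine WP.seq (WP.sumTo E.n (fun v => z v * lt01 (E.r v l) (s.nat 4 k v)) hn
      (fun s₂ h₂ => (hs₁.agree h₂ (by decide)).voters) (fun v _ s₂ h₂ hv => ?_)
      fun s₂ h₂ hsum => WP.seq (WP.setReal ?_))
    · have := hs₁.agree h₂ (by decide)
      simp only [RealExpr.eval, NatExpr.eval, ltE_eval, hv, this.voter, this.rank,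
        h₂.1 15 (by decide), hl₁, h₂.1 4 (by decide), h₁.1 4 (by decide), h₂.1 11 (by decide),
        h₁.1 11 (by decide), hk]
    have hs₂ := hs₁.agree h₂ (by decide)
    have h15 : s₂.nat 15 0 0 = l := by rw [h₂.1 15 (by decide), hl₁]
    have h6 : s₂.real 6 = s₁.real 6 := h₂.2 6 (by decide)
    simp only [RealExpr.eval, NatExpr.eval, h15, h6, hs₂.total, hs₂.budget, hs₂.weight, hsum,
      hI' l le_rfl, Nat.cast_ofNat]
    change WP M _ _ (s₂.setReal 6 0 l
      (A l + (E.score z (s.nat 4 k) l - 3 * (∑ v ∈ range E.n, z v) / κ * E.w l)))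
    generalize hx : A l + (E.score z (s.nat 4 k) l -
      3 * (∑ v ∈ range E.n, z v) / κ * E.w l) = x
    refine WP.ite (fun hb => WP.setReal ⟨fun i hi => ?_, fun i hi => ?_⟩) fun hb => WP.skip
      ⟨fun i hi => ?_, fun i hi => ?_⟩
    · simp only [Test.holds, RealExpr.eval, NatExpr.eval, State.setReal_nat, h15,
        State.setReal_real, and_self, if_true, Nat.cast_zero] at hb
      rcases Nat.lt_succ_iff_lt_or_eq.1 hi with hi | rfl
      · simpa [RealExpr.eval, NatExpr.eval, h15, hi.ne, h6] using hI i hi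
      · simp [RealExpr.eval, NatExpr.eval, h15, hrel, hx, hb.le]
    · have : i ≠ l := by omega
      simpa [RealExpr.eval, NatExpr.eval, h15, this, h6] using hI' i (by omega)
    · simp only [Test.holds, RealExpr.eval, NatExpr.eval, State.setReal_nat, h15,
        State.setReal_real, and_self, if_true, Nat.cast_zero, not_lt] at hb
      rcases Nat.lt_succ_iff_lt_or_eq.1 hi with hi | rfl
      · simpa [hi.ne, h6] using hI i hi
      · simp [hrel, hx, hb]
    · have : i ≠ l := by omega
      simpa [this, h6] using hI' i (by omega)
  · simp only [NatExpr.eval, hl₁] at hrel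
    refine ⟨fun i hi => ?_, fun i hi => ?_⟩
    · rcases Nat.lt_succ_iff_lt_or_eq.1 hi with hi | rfl
      · exact hI i hi
      · rw [if_neg hrel]
        exact hI' i le_rfl
    · exact hI' i (by omega)

theorem round_spec {k : ℕ} (hd : E.StageData z κ) (hs : HoldsStage E T z κ s)
    (hk : s.nat 11 0 0 = k) (hn : E.n ≤ M) (hm : 16 * E.m ≤ M)
    (hR : E.RoundInv z κ k (s.nat 5) (s.nat 4) (s.real 6 0)) :
    WP M round (fun s' => E.RoundInv z κ (k + 1) (s'.nat 5) (s'.nat 4) (s'.real 6 0)) s := by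
  have hm' : E.m ≤ M := by omega
  refine WP.seq (WP.fillNat E.n k (fun _ => E.m) hn (by decide)
    (fun s₁ h₁ => (hs.agree h₁ (by decide)).voters)
    (fun s₁ h₁ => by simp only [NatExpr.eval, h₁.1 11 (by decide), hk])
    (fun v _ s₁ h₁ _ _ => (hs.agree h₁ (by decide)).cands) fun s₁ h₁ h4 h4' => ?_)
  have hs₁ := hs.agree h₁ (by decide)
  have hk₁ : s₁.nat 11 0 0 = k := by rw [h₁.1 11 (by decide), hk]
  refine WP.seq (WP.fillNat E.m k (fun _ => 0) hm' (by decide)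
    (fun s₂ h₂ => (hs₁.agree h₂ (by decide)).cands)
    (fun s₂ h₂ => by simp only [NatExpr.eval, h₂.1 11 (by decide), hk₁])
    (fun v _ s₂ h₂ _ _ => rfl) fun s₂ h₂ h5 h5' => WP.seq (WP.setReal ?_))
  have hs₂ := hs₁.agree h₂ (by decide)
  simp only [NatExpr.eval, RealExpr.eval, Nat.cast_zero]
  set s₃ := s₂.setReal 8 0 0 0 with hs₃def
  have h₃ : Agree (setRvar 8 (constR 0)) s₂ s₃ := Agree.setReal
  have hs₃ := hs₂.agree h₃ (by decide)
  have h6 : s₃.real 6 = s.real 6 := by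
    rw [h₃.2 6 (by decide), h₂.2 6 (by decide), h₁.2 6 (by decide)]
  have h8 : s₃.real 8 0 0 = 0 := by simp [hs₃def]
  generalize hA : s.real 6 0 = A at hR
  refine WP.seq (WP.sumTo E.m (fun i => A i * E.w i) hm'
    (fun s₄ h₄ => (hs₃.agree h₄ (by decide)).cands) (fun i _ s₄ h₄ hi => ?_) fun s₄ h₄ hQw => ?_)
  · have := hs₃.agree h₄ (by decide)
    simp only [RealExpr.eval, NatExpr.eval, this.weight, hi, h₄.2 6 (by decide), h6, hA]
  have hs₄ := hs₃.agree h₄ (by decide)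
  have h6₄ : s₄.real 6 0 = A := by rw [h₄.2 6 (by decide), h6, hA]
  have hk₄ : s₄.nat 11 0 0 = k := by
    rw [h₄.1 11 (by decide), h₃.1 11 (by decide), h₂.1 11 (by decide), hk₁]
  have h4₄ : s₄.nat 4 = s₁.nat 4 := by
    rw [h₄.1 4 (by decide), h₃.1 4 (by decide), h₂.1 4 (by decide)]
  have h5₄ : s₄.nat 5 = s₂.nat 5 := by
    rw [h₄.1 5 (by decide), h₃.1 5 (by decide)]
  refine WP.seq (WP.forLoop (16 * E.m) (fun l s' =>
      E.GreedyInv z A κ l (s'.nat 5 k) (s'.nat 4 k) (s'.real 8 0 0) ∧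
      ∀ i, i ≠ k → s'.nat 5 i = s.nat 5 i ∧ s'.nat 4 i = s.nat 4 i) hm
    (fun s₅ h₅ => ?_) (by decide) ⟨?_, fun i hi => ⟨?_, ?_⟩⟩ (fun l hl s₅ h₅ _ hI => ?_)
    fun s₅ h₅ hI => ?_)
  · have := (hs₄.agree h₅ (by decide)).cands
    simp only [double, NatExpr.eval, this]
    omega
  · have h8₄ : s₄.real 8 0 0 = 0 := by rw [h₄.2 8 (by decide), h8]
    rw [State.setNat_real, h8₄]
    refine .zero hd hR.nonneg (fun i hi => ?_) (fun v hv => ?_)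
    · simp [h5₄, h5 i hi]
    · simp [h4₄, h4 v hv]
  · funext i'
    simp [h5₄, h5' i hi, h₁.1 5 (by decide)]
  · funext i'
    simp [h4₄, h4' i hi]
  · have hs₅ := hs₄.agree h₅ (by decide)
    have hk₅ : s₅.nat 11 0 0 = k := by rw [h₅.1 11 (by decide), hk₄]
    refine (greedyStep_spec hd hR.nonneg hR.eq_zero hs₅ hk₅ (by rw [h₅.2 6 (by decide), h6₄])
      (by rw [h₅.2 12 (by decide), hQw]) hn hm' hI.1).mono fun s₆ _ h => ⟨?_, fun i hi => ?_⟩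
    · exact h.1
    · exact ⟨(h.2 i hi).1.trans (hI.2 i hi).1, (h.2 i hi).2.trans (hI.2 i hi).2⟩
  · have hs₅ := hs₄.agree h₅ (by decide)
    have hk₅ : s₅.nat 11 0 0 = k := by rw [h₅.1 11 (by decide), hk₄]
    refine (updateCandidates_spec hs₅ hk₅ (by rw [h₅.2 6 (by decide), h6₄]) hn hm').mono
      fun s₆ h₆ h => ?_
    have h5₆ : s₆.nat 5 = s₅.nat 5 := h₆.1 5 (by decide)
    have h4₆ : s₆.nat 4 = s₅.nat 4 := h₆.1 4 (by decide)
    rw [h5₆, h4₆]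
    exact hR.succ hd (fun i hi => (hI.2 i hi.ne).1) (fun i hi => (hI.2 i hi.ne).2) hI.1 h

end

open Classical in
/-- The number of candidates below `m` with a smaller value of `x` than candidate `i`. -/
noncomputable def rankOf (m : ℕ) (x : ℕ → ℝ) (i : ℕ) : ℕ := #{j ∈ range m | x j < x i}

/-! ### Correctness of the stages and of the preprocessing -/

section

variable {E : Election} {T M : ℕ} {z : ℕ → ℝ} {κ : ℝ} {s : State}

theorem lottery_spec (hd : E.StageData z κ) (hs : Holds E T s) (hz : s.real 4 0 = z)
    (hκ : s.real 5 0 0 = κ) (hn : E.n ≤ M) (hm : 16 * E.m ≤ M) (hT : T ≤ M) :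
    WP M lottery (fun s' => HoldsStage E T z κ s' ∧
      E.RoundInv z κ T (s'.nat 5) (s'.nat 4) (s'.real 6 0)) s := by
  refine WP.seq (WP.sumTo E.n z hn (fun s₁ h₁ => (hs.agree h₁ (by decide)).voters)
    (fun v _ s₁ h₁ hv => ?_) fun s₁ h₁ hZ => ?_)
  · simp only [RealExpr.eval, NatExpr.eval, hv, h₁.2 4 (by decide), hz]
  have hs₁ : HoldsStage E T z κ s₁ :=
    { hs.agree h₁ (by decide) with
      voter := by rw [h₁.2 4 (by decide), hz]
      budget := by rw [h₁.2 5 (by decide), hκ]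
      total := hZ }
  refine WP.seq (WP.fillReal E.m (fun _ => 0) (by omega)
    (fun s₂ h₂ => (hs₁.agree h₂ (by decide)).cands)
    (fun i _ s₂ _ _ _ => by simp [RealExpr.eval, NatExpr.eval]) fun s₂ h₂ hA => ?_)
  have hs₂ := hs₁.agree h₂ (by decide)
  refine WP.forLoop T (fun k s' => E.RoundInv z κ k (s'.nat 5) (s'.nat 4) (s'.real 6 0)) hT
    (fun s₃ h₃ => (hs₂.agree h₃ (by decide)).rounds) (by decide) (.zero hA)
    (fun k _ s₃ h₃ hk hI => ?_) fun s₃ h₃ hI => ⟨hs₂.agree h₃ (by decide), hI⟩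
  exact round_spec hd (hs₂.agree h₃ (by decide)) hk hn hm hI

theorem computeDeficits_spec {k : ℕ} (hs : HoldsStage E T z κ s) (hk : s.nat 11 0 0 = k)
    (hn : E.n ≤ M) (hT : T ≤ M) :
    WP M computeDeficits (fun s' =>
      (∀ v < E.n, s'.nat 7 k v = Election.deficit T (s.nat 4) k v) ∧
      ∀ i, i ≠ k → s'.nat 7 i = s.nat 7 i) s := by
  refine WP.forLoop E.n (fun l s' =>
      (∀ v < l, s'.nat 7 k v = Election.deficit T (s.nat 4) k v) ∧
      ∀ i, i ≠ k → s'.nat 7 i = s.nat 7 i) hn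
    (fun s₁ h₁ => (hs.agree h₁ (by decide)).voters) (by decide)
    ⟨by simp, fun i _ => funext fun _ => by simp⟩ (fun v _ s₁ h₁ hv hI => ?_) fun _ _ h => h
  have hs₁ := hs.agree h₁ (by decide)
  refine WP.seq (WP.countTo T (fun s' => s.nat 4 k v < s.nat 4 s' v + 1) hT (by decide)
    (fun s₂ h₂ => (hs₁.agree h₂ (by decide)).rounds) (fun l _ s₂ h₂ hl => ?_)
    fun s₂ h₂ hcount => WP.setNat ?_)
  · simp only [Test.holds, NatExpr.eval, hl, h₂.1 4 (by decide), h₁.1 4 (by decide),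
      h₂.1 11 (by decide), h₁.1 11 (by decide), hk, h₂.1 14 (by decide), hv]
  have hs₂ := hs₁.agree h₂ (by decide)
  simp only [NatExpr.eval, h₂.1 11 (by decide), h₁.1 11 (by decide), hk, h₂.1 14 (by decide), hv,
    hs₂.rounds, hcount]
  refine ⟨fun l hl => ?_, fun i hi => funext fun l => ?_⟩
  · rcases Nat.lt_succ_iff_lt_or_eq.1 hl with hl | rfl
    · simpa [hl.ne, h₂.1 7 (by decide)] using hI.1 l hl
    · simp [Election.deficit, upperCount]
  · simp [hi, h₂.1 7 (by decide), hI.2 i hi]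

theorem select_spec (hs : HoldsStage E T z κ s) (hz : ∀ v < E.n, 0 ≤ z v) (hTpos : 0 < T)
    (hn : E.n ≤ M) (hT : T ≤ M) :
    WP M select (fun s' => s'.nat 6 0 0 < T ∧
      4 * ∑ v ∈ range E.n, z v * Election.deficit T (s.nat 4) (s'.nat 6 0 0) v ≤
        (∑ v ∈ range E.n, z v) * T ∧
      ∀ v < E.n, s'.nat 7 (s'.nat 6 0 0) v = Election.deficit T (s.nat 4) (s'.nat 6 0 0) v) s := by
  set P : ℕ → Prop := fun b => 4 * ∑ v ∈ range E.n, z v * Election.deficit T (s.nat 4) b v ≤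
        (∑ v ∈ range E.n, z v) * T with hP
  refine WP.seq (WP.setNat ?_)
  simp only [NatExpr.eval]
  set s₁ := s.setNat 6 0 0 0 with hs₁def
  have h₁ : Agree (setNvar 6 (.const 0)) s s₁ := Agree.setNat
  have hs₁ := hs.agree h₁ (by decide)
  refine WP.forLoop T (fun k s' =>
      (∀ b < k, ∀ v < E.n, s'.nat 7 b v = Election.deficit T (s.nat 4) b v) ∧
      ((∀ b < k, ¬ P b) ∨ (s'.nat 6 0 0 < k ∧ P (s'.nat 6 0 0)))) hT
    (fun s₂ h₂ => (hs₁.agree h₂ (by decide)).rounds) (by decide) ⟨by simp, by simp⟩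
    (fun k hk s₂ h₂ hk₂ hI => ?_) fun s₂ h₂ hI => ?_
  · have hs₂ := hs₁.agree h₂ (by decide)
    have h4₂ : s₂.nat 4 = s.nat 4 := by rw [h₂.1 4 (by decide), h₁.1 4 (by decide)]
    refine WP.seq ((computeDeficits_spec hs₂ hk₂ hn hT).mono fun s₃ h₃ hdef => ?_)
    have hs₃ := hs₂.agree h₃ (by decide)
    rw [h4₂] at hdef
    have hk₃ : s₃.nat 11 0 0 = k := by rw [h₃.1 11 (by decide), hk₂]
    refine WP.seq (WP.sumTo E.n (fun v => z v * Election.deficit T (s.nat 4) k v) hn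
      (fun s₄ h₄ => (hs₃.agree h₄ (by decide)).voters) (fun v hv s₄ h₄ hv₄ => ?_)
      fun s₄ h₄ hsum => ?_)
    · have := hs₃.agree h₄ (by decide)
      simp only [RealExpr.eval, NatExpr.eval, this.voter, hv₄, h₄.1 7 (by decide),
        h₄.1 11 (by decide), hk₃, hdef.1 v hv]
    have hs₄ := hs₃.agree h₄ (by decide)
    have hk₄ : s₄.nat 11 0 0 = k := by rw [h₄.1 11 (by decide), hk₃]
    have h7₄ : ∀ b < k + 1, ∀ v < E.n, s₄.nat 7 b v = Election.deficit T (s.nat 4) b v := by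
      intro b hb v hv
      rw [h₄.1 7 (by decide)]
      rcases Nat.lt_succ_iff_lt_or_eq.1 hb with hb | rfl
      · rw [hdef.2 b hb.ne]
        exact hI.1 b hb v hv
      · exact hdef.1 v hv
    have h6₄ : s₄.nat 6 0 0 = s₂.nat 6 0 0 := by rw [h₄.1 6 (by decide), h₃.1 6 (by decide)]
    have htest : Test.holds s₄ (.realLt (.mul (rvar 10) (.ofNat (nvar 8)))
        (.mul (constR 4) (rvar 9))) ↔ ¬ P k := by
      simp only [Test.holds, RealExpr.eval, NatExpr.eval, hs₄.total, hs₄.rounds, hsum, hP, not_le,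
        Nat.cast_ofNat]
    refine WP.ite (fun hb => WP.skip ⟨by simpa using h7₄, ?_⟩) fun hb => WP.setNat
      ⟨by simpa using h7₄, .inr ?_⟩
    · simp only [State.setNat_nat, h6₄]
      refine hI.2.imp (fun h b hb' => ?_) fun h => ⟨?_, ?_⟩
      · rcases Nat.lt_succ_iff_lt_or_eq.1 hb' with hb' | rfl
        · exact h b hb'
        · exact htest.1 hb
      · simpa using h.1.trans (Nat.lt_succ_self k)
      · simpa using h.2
    · have : P k := not_not.1 (mt htest.2 hb)
      simpa [NatExpr.eval, hk₄] using this
  -- The averaging argument excludes a failed search, so the initial value 0 of the register is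
  -- never mistaken for a result.
  · obtain ⟨b, hb, hPb⟩ := Election.exists_deficit_le hz hTpos (s.nat 4)
    rcases hI.2 with h | h
    · exact absurd hPb (h b hb)
    · exact ⟨h.1, h.2, hI.1 _ h.1⟩

theorem advance_spec {t : ℕ} {A : ℕ → ℝ} {R : ℕ → ℕ → ℕ} (hE : E.Valid)
    (hs : HoldsStage E T z κ s) (hS : E.StageInv t (fun i => s.nat 2 i 0) z κ)
    (hT : T = 1 + 2048 * E.m ^ 3) (hR : E.RoundInv z κ T (s.nat 5) R A)
    (hb : s.nat 6 0 0 < T)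
    (hbest : 4 * ∑ v ∈ range E.n, z v * Election.deficit T R (s.nat 6 0 0) v ≤
        (∑ v ∈ range E.n, z v) * T)
    (hdef : ∀ v < E.n, s.nat 7 (s.nat 6 0 0) v = Election.deficit T R (s.nat 6 0 0) v)
    (hn : E.n ≤ M) (hm : E.m ≤ M) :
    WP M advance (fun s' => E.StageInv (t + 1) (fun i => s'.nat 2 i 0) (s'.real 4 0)
      (s'.real 5 0 0)) s := by
  refine WP.seq (WP.fillReal E.n
    (fun v => z v * Election.deficit T R (s.nat 6 0 0) v / T) hn
    (fun s₁ h₁ => (hs.toHolds.agree h₁ (by decide)).voters) (fun v hv s₁ h₁ hv₁ h4 => ?_)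
    fun s₁ h₁ hz' => ?_)
  · simp only [RealExpr.eval, NatExpr.eval, hv₁, h4, hs.voter, h₁.1 7 (by decide),
      h₁.1 6 (by decide), hdef v hv, (hs.toHolds.agree h₁ (by decide)).rounds]
  have hs₁ := hs.toHolds.agree h₁ (by decide)
  have h6 : s₁.nat 6 = s.nat 6 := h₁.1 6 (by decide)
  have h5 : s₁.nat 5 = s.nat 5 := h₁.1 5 (by decide)
  have h2 : s₁.nat 2 = s.nat 2 := h₁.1 2 (by decide)
  refine WP.seq (WP.forLoop E.m (fun l s' =>
      (∀ i < l, s'.nat 2 i 0 = if 0 < s.nat 5 (s.nat 6 0 0) i then 1 else s.nat 2 i 0) ∧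
      ∀ i, l ≤ i → s'.nat 2 i 0 = s.nat 2 i 0) hm
    (fun s₂ h₂ => (hs₁.agree h₂ (by decide)).cands) (by decide)
    ⟨by simp, fun i _ => by simp [h2]⟩ (fun l _ s₂ h₂ hl hI => ?_)
    fun s₂ h₂ hI => WP.setReal ?_)
  · have htest : Test.holds s₂ (.natLt (.const 0) (.get 5 (nvar 6) (nvar 15))) ↔
        0 < s.nat 5 (s.nat 6 0 0) l := by
      simp only [Test.holds, NatExpr.eval, hl, h₂.1 5 (by decide), h5, h₂.1 6 (by decide), h6]
    refine WP.ite (fun hb => WP.setNat ⟨fun i hi => ?_, fun i hi => ?_⟩) fun hb => WP.skip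
      ⟨fun i hi => ?_, fun i hi => ?_⟩
    · rcases Nat.lt_succ_iff_lt_or_eq.1 hi with hi | rfl
      · simpa [NatExpr.eval, hl, hi.ne] using hI.1 i hi
      · simp [NatExpr.eval, hl, htest.1 hb]
    · have : i ≠ l := by omega
      simpa [NatExpr.eval, hl, this] using hI.2 i (by omega)
    · rcases Nat.lt_succ_iff_lt_or_eq.1 hi with hi | rfl
      · simpa using hI.1 i hi
      · rw [if_neg (mt htest.2 hb)]
        simpa using hI.2 i le_rfl
    · simpa using hI.2 i (by omega)
  · refine hS.succ hE hT hR hb hbest (fun v hv => ?_) hI.1 ?_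
    · rw [← hz' v hv, ← h₂.2 4 (by decide)]
      simp
    · simp [RealExpr.eval, NatExpr.eval, h₂.2 5 (by decide), h₁.2 5 (by decide), hs.budget]

theorem stage_spec {t : ℕ} (hE : E.Valid) (hs : Holds E T s)
    (hS : E.StageInv t (fun i => s.nat 2 i 0) (s.real 4 0) (s.real 5 0 0))
    (hT : T = 1 + 2048 * E.m ^ 3) (hn : E.n ≤ M) (hm : 16 * E.m ≤ M) (hTM : T ≤ M) :
    WP M stage (fun s' => E.StageInv (t + 1) (fun i => s'.nat 2 i 0) (s'.real 4 0)
      (s'.real 5 0 0)) s := by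
  have hd := hS.stageData hE
  refine WP.seq ((lottery_spec hd hs rfl rfl hn hm hTM).mono fun s₁ h₁ ⟨hs₁, hR⟩ =>
    WP.seq ((select_spec hs₁ hS.nonneg (by omega) hn hTM).mono fun s₂ h₂ ⟨hb, hbest, hdef⟩ => ?_))
  rw [← h₁.1 2 (by decide), ← h₂.1 2 (by decide)] at hS
  rw [← h₂.1 5 (by decide)] at hR
  exact advance_spec hE (hs₁.agree h₂ (by decide)) hS hT hR hb hbest hdef hn (by omega)

theorem prepare_spec (hE : E.Valid) (hs : Holds E T s) (hout : ∀ i, s.nat 2 i 0 = 0)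
    (hn : E.n ≤ M) (hm : E.m ≤ M) :
    WP M prepare (fun s' => E.StageInv 0 (fun i => s'.nat 2 i 0) (s'.real 4 0)
      (s'.real 5 0 0)) s := by
  refine WP.seq (WP.forLoop E.m (fun l s' =>
      (∀ i < l, (0 < s'.nat 2 i 0 ↔ ¬ E.Large i) ∧ s'.nat 2 i 0 ≤ 1) ∧
      ∀ i, l ≤ i → s'.nat 2 i 0 = 0) hm
    (fun s₁ h₁ => (hs.agree h₁ (by decide)).cands) (by decide)
    ⟨by simp, fun i _ => by simp [hout]⟩ (fun l _ s₁ h₁ hl hI => ?_) fun s₁ h₁ hI => ?_)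
  · have hs₁ := hs.agree h₁ (by decide)
    have htest := holds_largeTest hs₁ (e := nvar 15)
    simp only [NatExpr.eval, hl] at htest
    refine WP.ite (fun hb => WP.skip ⟨fun i hi => ?_, fun i hi => ?_⟩) fun hb => WP.setNat
      ⟨fun i hi => ?_, fun i hi => ?_⟩
    · rcases Nat.lt_succ_iff_lt_or_eq.1 hi with hi | rfl
      · simpa using hI.1 i hi
      · simp [htest.1 hb, hI.2 i le_rfl]
    · simpa using hI.2 i (by omega)
    · rcases Nat.lt_succ_iff_lt_or_eq.1 hi with hi | rfl
      · simpa [NatExpr.eval, hl, hi.ne] using hI.1 i hi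
      · simp [NatExpr.eval, hl, mt htest.2 hb]
    · have : i ≠ l := by omega
      simpa [NatExpr.eval, hl, this] using hI.2 i (by omega)
  have hs₁ := hs.agree h₁ (by decide)
  refine WP.seq (WP.fillReal E.n (fun _ => 1) hn
    (fun s₂ h₂ => (hs₁.agree h₂ (by decide)).voters)
    (fun v _ s₂ _ _ _ => by simp [RealExpr.eval, NatExpr.eval]) fun s₂ h₂ hz => WP.setReal ?_)
  refine .zero hE ?_ (fun v hv => ?_) (fun i hi => ?_) fun i hi => ?_
  · simp [RealExpr.eval, NatExpr.eval, (hs₁.agree h₂ (by decide)).limit]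
  · simpa using hz v hv
  · simpa [h₂.1 2 (by decide)] using (hI.1 i hi).1
  · simpa [h₂.1 2 (by decide)] using (hI.1 i hi).2

/-- m² and m³ are obtained by repeated addition into cells that are zero in the initial memory. -/
theorem computeRounds_spec {m : ℕ} (h0 : s.nat 0 0 0 = m) (h17 : s.nat 17 0 0 = 0)
    (h18 : s.nat 18 0 0 = 0) (hm : m ≤ M) (hM : 2048 ≤ M) :
    WP M computeRounds (fun s' => s'.nat 8 0 0 = 1 + 2048 * m ^ 3) s := by
  refine WP.seq (WP.addNatLoop m (fun _ => m) hm (by decide)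
    (fun s₁ h₁ => by simp only [NatExpr.eval, h₁.1 0 (by decide), h0])
    (fun i _ s₁ h₁ _ => by simp only [NatExpr.eval, h₁.1 0 (by decide), h0]) fun s₁ h₁ hsq => ?_)
  refine WP.seq (WP.addNatLoop m (fun _ => m * m) hm (by decide)
    (fun s₂ h₂ => by simp only [NatExpr.eval, h₂.1 0 (by decide), h₁.1 0 (by decide), h0])
    (fun i _ s₂ h₂ _ => ?_) fun s₂ h₂ hcube => WP.seq (WP.setNat ?_))
  · simp [NatExpr.eval, h₂.1 17 (by decide), hsq, h17]
  have h18₂ : s₂.nat 18 0 0 = m * (m * m) := by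
    simp [hcube, h₁.1 18 (by decide), h18]
  simp only [NatExpr.eval]
  refine WP.addNatLoop 2048 (fun _ => m * (m * m)) hM (by decide) (fun _ _ => rfl)
    (fun i _ s₃ h₃ _ => ?_) fun s₃ h₃ h => ?_
  · simp [NatExpr.eval, h₃.1 18 (by decide), h18₂]
  · rw [h]
    simp only [State.setNat_nat, and_self, if_true, sum_const, card_range, smul_eq_mul]
    ring

theorem computeRanks_spec {m n : ℕ} (h0 : s.nat 0 0 0 = m) (h1 : s.nat 1 0 0 = n)
    (hn : n ≤ M) (hm : m ≤ M) :
    WP M computeRanks (fun s' => ∀ v < n, ∀ i < m,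
      s'.nat 3 v i = rankOf m (s.real 3 v) i) s := by
  refine WP.forLoop n (fun k s' => ∀ v < k, ∀ i < m,
      s'.nat 3 v i = rankOf m (s.real 3 v) i) hn
    (fun s₁ h₁ => by simp only [NatExpr.eval, h₁.1 1 (by decide), h1]) (by decide) (by simp)
    (fun k _ s₁ h₁ hk hI => ?_) fun _ _ h => h
  have h0₁ : s₁.nat 0 0 0 = m := by rw [h₁.1 0 (by decide), h0]
  refine WP.forLoop m (fun l s' => (∀ v < k, ∀ i < m,
      s'.nat 3 v i = rankOf m (s.real 3 v) i) ∧
      ∀ i < l, s'.nat 3 k i = rankOf m (s.real 3 k) i) hm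
    (fun s₂ h₂ => by simp only [NatExpr.eval, h₂.1 0 (by decide), h0₁]) (by decide)
    ⟨by simpa using hI, by simp⟩ (fun l _ s₂ h₂ hl hI => ?_) fun s₂ h₂ hI v hv i hi => ?_
  · have h0₂ : s₂.nat 0 0 0 = m := by rw [h₂.1 0 (by decide), h0₁]
    have hk₂ : s₂.nat 14 0 0 = k := by rw [h₂.1 14 (by decide), hk]
    classical
    refine WP.seq (WP.countTo m (fun j => s.real 3 k j < s.real 3 k l) hm (by decide)
      (fun s₃ h₃ => by simp only [NatExpr.eval, h₃.1 0 (by decide), h0₂])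
      (fun j _ s₃ h₃ hj => ?_) fun s₃ h₃ hcount => WP.setNat ?_)
    · simp only [Test.holds, RealExpr.eval, NatExpr.eval, hj, h₃.1 14 (by decide), hk₂,
        h₃.1 15 (by decide), hl, h₃.2 3 (by decide), h₂.2 3 (by decide), h₁.2 3 (by decide)]
    simp only [NatExpr.eval, hcount, h₃.1 14 (by decide), hk₂, h₃.1 15 (by decide), hl]
    have h3 : s₃.nat 3 = s₂.nat 3 := h₃.1 3 (by decide)
    refine ⟨fun v hv i hi => ?_, fun i hi => ?_⟩
    · simpa [hv.ne, h3] using hI.1 v hv i hi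
    · rcases Nat.lt_succ_iff_lt_or_eq.1 hi with hi | rfl
      · simpa [hi.ne, h3] using hI.2 i hi
      · simp [rankOf]
  · rcases Nat.lt_succ_iff_lt_or_eq.1 hv with hv | rfl
    · simpa using hI.1 v hv i hi
    · simpa using hI.2 i hi

end

/-! ### Ranks instead of scores, and the whole algorithm -/

theorem rankOf_lt_rankOf {m : ℕ} {x : ℕ → ℝ} {i j : ℕ} (hi : i < m) :
    rankOf m x i < rankOf m x j ↔ x i < x j := by
  classical
  unfold rankOf
  constructor
  · intro h
    by_contra! hle
    exact absurd h (not_lt.2 (card_le_card (monotone_filter_right _ fun _ _ hk => hk.trans_le hle)))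
  · intro h
    refine card_lt_card ⟨monotone_filter_right _ fun _ _ hk => hk.trans h, fun hsub => ?_⟩
    exact lt_irrefl _ (mem_filter.1 (hsub (mem_filter.2 ⟨mem_range.2 hi, h⟩))).2

theorem rankOf_lt {m : ℕ} (x : ℕ → ℝ) {i : ℕ} (hi : i < m) : rankOf m x i < m := by
  classical
  refine lt_of_lt_of_eq (card_lt_card ⟨filter_subset _ _, fun hsub => ?_⟩) (card_range m)
  exact lt_irrefl _ (mem_filter.1 (hsub (mem_range.2 hi))).2

/-- A bound for the number of iterations of every loop of `committeeProgram`. -/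
def loopBound (m n : ℕ) : ℕ := 2048 * m ^ 3 + 16 * m + n + 2048

/-- Positions and distances enter only through comparisons for a fixed voter, so both settings are
instances of `ComparesByScore`. -/
theorem committeeProgram_computesStable {m n : ℕ} (ε K : ℝ) (w : Fin m → ℝ)
    (x : Fin n → Fin m → ℝ) (P : Preferences n m) (hP : ComparesByScore P x) (hε : 0 < ε)
    (hw : ∀ i, 0 ≤ w i) (hK : 0 < K) :
    ComputesStable committeeProgram (committeeProgram.timeBound (loopBound m n) : ℕ) ε K w x P
      (32 + ε) := by
  set M := loopBound m n with hMdef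
  have hM : M = 2048 * m ^ 3 + 16 * m + n + 2048 := rfl
  clear_value M
  set s₀ := input ε K w x with hs₀
  have hout : ∀ i, s₀.nat 2 i 0 = 0 := fun i => by simp [hs₀, input]
  have hwt : ∀ i : Fin m, s₀.real 2 i 0 = w i := fun i => by simp [hs₀, input]
  have hx : ∀ (v : Fin n) (i : Fin m), s₀.real 3 v i = x v i := fun v i => by simp [hs₀, input]
  suffices h : WP M committeeProgram (fun s' => IsApproxStable P w K (32 + ε) (output m s')) s₀ by
    obtain ⟨s', t, h1, h2, h3⟩ := h
    exact ⟨s', t, h1, by exact_mod_cast h2, h3⟩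
  refine WP.seq ((computeRanks_spec (m := m) (n := n) (by simp [hs₀, input]) (by simp [hs₀, input])
    (by omega) (by omega)).mono fun s₁ h₁ hrank => ?_)
  refine WP.seq ((computeRounds_spec (m := m)
    (by rw [h₁.1 0 (by decide)]; simp [hs₀, input])
    (by rw [h₁.1 17 (by decide)]; simp [hs₀, input])
    (by rw [h₁.1 18 (by decide)]; simp [hs₀, input]) (by omega) (by omega)).mono
    fun s₂ h₂ hrounds => ?_)
  set E : Election := ⟨n, m, s₁.nat 3, fun i => s₀.real 2 i 0, K⟩ with hEdef
  set T := 1 + 2048 * m ^ 3 with hT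
  have hE : E.Valid := by
    refine ⟨fun v hv i hi => ?_, fun i hi => ?_, hK⟩
    · change s₁.nat 3 v i < m
      rw [hrank v hv i hi]
      exact rankOf_lt _ hi
    · change 0 ≤ s₀.real 2 i 0
      rw [hwt ⟨i, hi⟩]
      exact hw _
  have hs₂ : Holds E T s₂ :=
    { cands := by
        rw [h₂.1 0 (by decide), h₁.1 0 (by decide)]
        simp [hs₀, input, hEdef]
      voters := by
        rw [h₂.1 1 (by decide), h₁.1 1 (by decide)]
        simp [hs₀, input, hEdef]
      rank := h₂.1 3 (by decide)
      rounds := hrounds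
      limit := by
        rw [h₂.2 1 (by decide), h₁.2 1 (by decide)]
        simp [hs₀, input, hEdef]
      weight := fun i => by rw [h₂.2 2 (by decide), h₁.2 2 (by decide)] }
  have hn : E.n ≤ M := by simp only [hEdef]; omega
  have hm : 16 * E.m ≤ M := by simp only [hEdef]; omega
  have hTM : T ≤ M := by omega
  refine WP.seq ((prepare_spec hE hs₂ (fun i => ?_) hn (by omega)).mono fun s₃ h₃ hS => ?_)
  · rw [h₂.1 2 (by decide), h₁.1 2 (by decide), hout]
  have hs₃ := hs₂.agree h₃ (by decide)
  refine WP.forLoop (n + 2) (fun t s' => E.StageInv t (fun i => s'.nat 2 i 0) (s'.real 4 0)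
      (s'.real 5 0 0)) (by omega)
    (fun s₄ h₄ => ?_) (by decide) (by simpa using hS) (fun t _ s₄ h₄ _ hI => ?_) fun s₄ h₄ hI => ?_
  · have : s₄.nat 1 0 0 = n := (hs₃.agree h₄ (by decide)).voters
    simp only [NatExpr.eval, this]
  · refine (stage_spec hE (hs₃.agree h₄ (by decide)) hI rfl hn hm hTM).mono fun s₅ _ h => ?_
    simpa using h
  have hmem : ∀ i : Fin m, i ∈ output m s₄ ↔ 0 < s₄.nat 2 i 0 := fun i => by
    have := hI.mem_le_one i i.2
    simp only [output, mem_filter, mem_univ, true_and]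
    omega
  rw [isApproxStable_iff_upTo_one P hP.singleton w K (32 + ε) hw hK (by linarith)]
  refine ⟨?_, fun S' hcard hb => ?_⟩
  · have h1 : weight w (output m s₄) = E.committeeWeight fun i => s₄.nat 2 i 0 := by
      unfold weight Election.committeeWeight
      rw [Finset.sum_range, ← Finset.sum_filter]
      refine sum_congr (ext fun i => ?_) fun i _ => (hwt i).symm
      simpa using hmem i
    have := hI.weight_le
    have hpos := (hI.stageData hE).budget_pos
    rw [h1]
    change _ + _ ≤ K at this
    linarith
  · obtain ⟨hpos, hb⟩ := hb
    classical
    -- Nobody strictly prefers the empty committee, so the deviation is a singleton.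
    have hne : S'.Nonempty := by
      by_contra hcon
      rw [not_nonempty_iff_eq_empty] at hcon
      obtain ⟨v, hv⟩ := card_pos.1 hpos
      obtain ⟨i, hi, -⟩ := (hP v _ _).1 (mem_filter.1 hv).2
      simp [hcon] at hi
    obtain ⟨i, rfl⟩ := card_eq_one.1 (le_antisymm hcard (card_pos.2 hne))
    -- Ranks preserve strict comparisons of scores, so the dissenters in the memory are exactly the
    -- deviating voters.
    have hscore : pairwiseScore P (output m s₄) {i} =
        #(E.dissenters (fun i => s₄.nat 2 i 0) i) := by
      unfold pairwiseScore
      refine card_bij (fun v _ => (v : ℕ)) (fun v hv => ?_) (fun _ _ _ _ h => Fin.ext h)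
        fun v hv => ?_
      · obtain ⟨i', hi', h⟩ := (hP v _ _).1 (mem_filter.1 hv).2
        rw [mem_singleton.1 hi'] at h
        refine mem_filter.2 ⟨mem_range.2 v.2, fun j hj hj' => ?_⟩
        change s₁.nat 3 v i < s₁.nat 3 v j
        rw [hrank v v.2 i i.2, hrank v v.2 j hj, rankOf_lt_rankOf i.2, hx v i, hx v ⟨j, hj⟩]
        exact h ⟨j, hj⟩ ((hmem ⟨j, hj⟩).2 hj')
      · obtain ⟨hv, h⟩ := mem_filter.1 hv
        have hv : v < n := mem_range.1 hv
        refine ⟨⟨v, hv⟩, mem_filter.2 ⟨mem_univ _, (hP _ _ _).2 ⟨i, mem_singleton_self i,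
          fun j hj => ?_⟩⟩, rfl⟩
        have h := h j j.2 ((hmem j).1 hj)
        change s₁.nat 3 v i < s₁.nat 3 v j at h
        rwa [hrank v hv i i.2, hrank v hv j j.2, rankOf_lt_rankOf i.2, hx ⟨v, hv⟩ i,
          hx ⟨v, hv⟩ j] at h
    rw [hscore] at hpos hb
    have hlt := hI.card_dissenters_lt hE le_rfl i.2 hpos
    change _ < 32 * (s₀.real 2 i 0 / K) * (n : ℝ) at hlt
    rw [hwt i] at hlt
    simp only [weight, sum_singleton] at hb
    have : 0 ≤ ε * (w i / K) * n := by
      have := hw i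
      positivity
    linarith

/-- Substitute the polynomial `loopBound` for M in the time bound; the third variable does not
occur. -/
theorem exists_timeBound_loopBound_eq_eval (p : Program) :
    ∃ Q : MvPolynomial (Fin 3) ℝ, ∀ (m n : ℕ) (y : ℝ),
      MvPolynomial.eval ![(m : ℝ), (n : ℝ), y] Q = (p.timeBound (loopBound m n) : ℕ) := by
  obtain ⟨P, hP⟩ := p.exists_timeBound_eq_eval
  refine ⟨P.eval₂ (Nat.castRingHom _) (2048 * .X 0 ^ 3 + 16 * .X 0 + .X 1 + 2048),
    fun m n y => ?_⟩
  rw [Polynomial.hom_eval₂, hP]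
  refine Eq.trans ?_ (Polynomial.eval₂_at_apply (p := P) (Nat.castRingHom ℝ) (loopBound m n))
  congr 1
  · exact Subsingleton.elim _ _
  · simp [loopBound]

end CommitteeSelection

theorem mainTheorem8 :
    (∃ (p : CommitteeSelection.Program) (Q : MvPolynomial (Fin 3) ℝ) (ε₀ : ℝ), 0 < ε₀ ∧
      ∀ ε : ℝ, 0 < ε → ε ≤ ε₀ →
      ∀ (m n : ℕ) (w : Fin m → ℝ) (K : ℝ), (∀ i, 0 ≤ w i) → 0 < K →
        (∀ R : CommitteeSelection.RankingProfile n m,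
          CommitteeSelection.ComputesStable p (MvPolynomial.eval ![(m : ℝ), (n : ℝ), 1 / ε] Q)
            ε K w (fun v i => (R.position v i : ℝ)) R.preferences (32 + ε)) ∧
        (∀ d : PseudoMetricSpace (Fin m ⊕ Fin n),
          CommitteeSelection.ComputesStable p (MvPolynomial.eval ![(m : ℝ), (n : ℝ), 1 / ε] Q)
            ε K w (CommitteeSelection.voterDist d) (CommitteeSelection.facilityPreferences d)
            (32 + ε))) ∧
    (∀ (m n : ℕ) (w : Fin m → ℝ) (K c : ℝ), (∀ i, 0 ≤ w i) → 0 < K → 1 ≤ c →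
      (∀ (R : CommitteeSelection.RankingProfile n m) (S : Finset (Fin m)),
        CommitteeSelection.IsApproxStable R.preferences w K c S ↔
          CommitteeSelection.IsApproxStableUpTo R.preferences w K c 1 S) ∧
      (∀ (d : PseudoMetricSpace (Fin m ⊕ Fin n)) (S : Finset (Fin m)),
        CommitteeSelection.IsApproxStable (CommitteeSelection.facilityPreferences d) w K c S ↔
          CommitteeSelection.IsApproxStableUpTo
            (CommitteeSelection.facilityPreferences d) w K c 1 S)) := by
  obtain ⟨Q, hQ⟩ := CommitteeSelection.exists_timeBound_loopBound_eq_eval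
    CommitteeSelection.committeeProgram
  -- Any positive ε₀ would do, since the construction is already stable with factor 32.
  refine ⟨⟨CommitteeSelection.committeeProgram, Q, 1, one_pos, fun ε hε _ m n w K hw hK =>
    ⟨fun R => ?_, fun d => ?_⟩⟩,
    fun m n w K c hw hK hc => ⟨fun R S => ?_, fun d S => ?_⟩⟩
  · rw [hQ]
    exact CommitteeSelection.committeeProgram_computesStable ε K w _ _ R.comparesByScore hε hw hK
  · rw [hQ]
    exact CommitteeSelection.committeeProgram_computesStable ε K w _ _
      (CommitteeSelection.facilityPreferences_comparesByScore d) hε hw hK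
  · exact CommitteeSelection.isApproxStable_iff_upTo_one _
      R.comparesByScore.singleton w K c hw hK hc S
  · exact CommitteeSelection.isApproxStable_iff_upTo_one _
      (CommitteeSelection.facilityPreferences_comparesByScore d).singleton w K c hw hK hc S
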